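/- For a functional $\ell$ write $e^{-tA_N}\ell=\sum_{k\ge 0}e^{-tk^2}\langle \ell,\varphi_k\rangle\varphi_k$ for the heat semigroup on $(0,\pi)$ with homogeneous Neumann boundary conditions, where $\varphi_0=1/\sqrt{\pi}$ and $\varphi_k(x)=\sqrt{2/\pi}\,\cos(kx)$ for $k\ge 1$. Put $$a(t)=-\bigl(e^{-tA_N}\delta_0\bigr)(\pi)=-\frac1\pi+\frac2\pi\sum_{k=1}^\infty(-1)^{k+1}e^{-tk^2},\qquad t>0,$$ and, for $u_0\in H^1(0,\pi)$ (real valued), $$f(t)=\bigl(e^{-tA_N}u_0\bigr)(\pi)=\sum_{k=0}^\infty e^{-tk^2}\Bigl(\int_0^\pi u_0\varphi_k\,dx\Bigr)\varphi_k(\pi),\qquad t>0 .$$ Let $$\omega_0=\min\bigl\{\omega>0:\ \sqrt{i\omega}\,\sin(\sqrt{i\omega}\,\pi)\ \text{is a positive real number}\bigr\},\qquad \beta_0=\sqrt{i\omega_0}\,\sin(\sqrt{i\omega_0}\,\pi)\approx 5.6655 .$$ **Proposition.** Let $\beta\in(0,\beta_0)$ and $u_0\in H^1(0,\pi)$, and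 let $y:(0,\infty)\to\mathbb{R}$ be a bounded continuous function such that $$y(t)=f(t)+\int_0^t a(t-\tau)\tanh\bigl(\beta y(\tau)\bigr)\,d\tau\qquad\text{for all } t>0 .$$ Then $\lim_{t\to\infty}y(t)=0$. -/

import Mathlib

namespace Thermostat

open MeasureTheory Set

noncomputable section

/-- `v` is the weak derivative of `u` on the interval `(0, π)`: the integration by parts formula
holds against every smooth function with compact support in `(0, π)`. -/
def IsWeakDeriv (u v : ℝ → ℝ) : Prop :=
  ∀ φ : ℝ → ℝ, ContDiff ℝ (⊤ : ℕ∞) φ → HasCompactSupport φ → tsupport φ ⊆ Ioo 0 Real.pi →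
    ∫ x in Ioo 0 Real.pi, u x * deriv φ x = -∫ x in Ioo 0 Real.pi, v x * φ x

/-- The Sobolev space `H¹(0, π)`: `u` is square integrable on `(0, π)` and has a weak derivative
there that is square integrable. -/
def MemH1 (u : ℝ → ℝ) : Prop :=
  MemLp u 2 (volume.restrict (Ioo 0 Real.pi)) ∧
    ∃ v : ℝ → ℝ, MemLp v 2 (volume.restrict (Ioo 0 Real.pi)) ∧ IsWeakDeriv u v

/-- The `L²(0, π)`-normalised eigenfunctions of the Neumann Laplacian `A_N` on `(0, π)`, with
eigenvalue `k ^ 2`: `φ₀ = 1 / √π` and `φₖ(x) = √(2 / π) cos (k x)` for `k ≥ 1`. -/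
def eigenfun (k : ℕ) (x : ℝ) : ℝ :=
  if k = 0 then 1 / √Real.pi else √(2 / Real.pi) * Real.cos (k * x)

/-- The functional on functions on `[0, π]` given by `L²(0, π)`-pairing with `u`. -/
def pairing (u : ℝ → ℝ) (v : ℝ → ℝ) : ℝ := ∫ x in Ioo 0 Real.pi, u x * v x

/-- The Dirac functional `δ₀`. -/
def dirac0 (v : ℝ → ℝ) : ℝ := v 0

/-- The value at `x` of `e^{-t A_N} ℓ`, for a functional `ℓ`, through the spectral resolution of
the Neumann Laplacian: `∑ₖ e^{-t k²} ⟨ℓ, φₖ⟩ φₖ(x)`. -/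
def heatSemigroup (t : ℝ) (ℓ : (ℝ → ℝ) → ℝ) (x : ℝ) : ℝ :=
  ∑' k : ℕ, Real.exp (-t * (k : ℝ) ^ 2) * ℓ (eigenfun k) * eigenfun k x

/-- The forcing term `f(t) = (e^{-t A_N} u₀)(π)`. -/
def forcing (u₀ : ℝ → ℝ) (t : ℝ) : ℝ := heatSemigroup t (pairing u₀) Real.pi

/-- The convolution kernel `a(t) = -(e^{-t A_N} δ₀)(π)`. -/
def kernel (t : ℝ) : ℝ := -heatSemigroup t dirac0 Real.pi

lemma eigenfun_zero_mul_eigenfun_pi (k : ℕ) :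
    eigenfun k 0 * eigenfun k Real.pi =
      if k = 0 then 1 / Real.pi else 2 / Real.pi * (-1) ^ k := by
  unfold eigenfun
  split_ifs with h
  · rw [div_mul_div_comm, Real.mul_self_sqrt Real.pi_pos.le, one_mul]
  · have h2 : (0 : ℝ) ≤ 2 / Real.pi := by positivity
    rw [mul_zero, Real.cos_zero, mul_one, Real.cos_nat_mul_pi, ← mul_assoc, Real.mul_self_sqrt h2]

lemma summable_exp_sq {t : ℝ} (ht : 0 < t) :
    Summable fun k : ℕ => Real.exp (-t * (k : ℝ) ^ 2) := by
  have h : Summable fun k : ℕ => Real.exp (k * -t) :=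
    Real.summable_exp_nat_mul_iff.mpr (by linarith)
  refine Summable.of_nonneg_of_le (fun _ => (Real.exp_pos _).le) (fun k => ?_) h
  apply Real.exp_le_exp.mpr
  have hk : (k : ℝ) ≤ (k : ℝ) ^ 2 := by exact_mod_cast Nat.le_self_pow two_ne_zero k
  nlinarith

/-- The series representation of the kernel `a`, for `t > 0`. -/
theorem hasSum_kernel {t : ℝ} (ht : 0 < t) :
    HasSum (fun k : ℕ => 2 / Real.pi * ((-1) ^ (k + 2) * Real.exp (-t * ((k : ℝ) + 1) ^ 2)))
      (kernel t + 1 / Real.pi) := by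
  have hterm : ∀ k : ℕ, Real.exp (-t * (k : ℝ) ^ 2) * dirac0 (eigenfun k) * eigenfun k Real.pi =
      Real.exp (-t * (k : ℝ) ^ 2) *
        (if k = 0 then 1 / Real.pi else 2 / Real.pi * (-1) ^ k) := fun k => by
    rw [← eigenfun_zero_mul_eigenfun_pi, mul_assoc]; rfl
  have hs : Summable fun k : ℕ => Real.exp (-t * (k : ℝ) ^ 2) *
      (if k = 0 then 1 / Real.pi else 2 / Real.pi * (-1) ^ k) := by
    refine Summable.of_norm_bounded ((summable_exp_sq ht).mul_right (2 / Real.pi)) fun k => ?_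
    rw [norm_mul, Real.norm_eq_abs, Real.abs_exp]
    refine mul_le_mul_of_nonneg_left ?_ (Real.exp_pos _).le
    have hp := Real.pi_pos
    split_ifs
    · rw [Real.norm_of_nonneg (by positivity)]
      gcongr
      norm_num
    · rw [norm_mul, norm_pow, norm_neg, norm_one, one_pow, mul_one,
        Real.norm_of_nonneg (by positivity)]
  have h0 := (hasSum_nat_add_iff' 1).mpr hs.hasSum
  have h1 := h0.neg
  have e1 : kernel t = -∑' k : ℕ, Real.exp (-t * (k : ℝ) ^ 2) *
      (if k = 0 then 1 / Real.pi else 2 / Real.pi * (-1) ^ k) := by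
    unfold kernel heatSemigroup
    rw [tsum_congr hterm]
  have e2 : kernel t + 1 / Real.pi = -((∑' k : ℕ, Real.exp (-t * (k : ℝ) ^ 2) *
      (if k = 0 then 1 / Real.pi else 2 / Real.pi * (-1) ^ k)) -
      ∑ i ∈ Finset.range 1, Real.exp (-t * (i : ℝ) ^ 2) *
        (if i = 0 then 1 / Real.pi else 2 / Real.pi * (-1) ^ i)) := by
    rw [e1, Finset.sum_range_one, if_pos rfl]
    norm_num
    ring
  rw [e2]
  have e3 : (fun k : ℕ => 2 / Real.pi * ((-1) ^ (k + 2) * Real.exp (-t * ((k : ℝ) + 1) ^ 2))) =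
      fun k : ℕ => -(Real.exp (-t * ((k + 1 : ℕ) : ℝ) ^ 2) *
        (if k + 1 = 0 then 1 / Real.pi else 2 / Real.pi * (-1) ^ (k + 1))) := by
    funext k
    rw [if_neg (Nat.succ_ne_zero k)]
    push_cast
    ring
  rw [e3]
  exact h1

/-- `√(iω) sin (√(iω) π)`; the value does not depend on the choice of the square root. -/
def charFun (ω : ℝ) : ℂ :=
  Complex.sqrt (Complex.I * ω) * Complex.sin (Complex.sqrt (Complex.I * ω) * Real.pi)

/-- The frequencies `ω > 0` at which `√(iω) sin (√(iω) π)` is a positive real number. -/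
def criticalSet : Set ℝ := {ω | 0 < ω ∧ (charFun ω).im = 0 ∧ 0 < (charFun ω).re}

/-- The smallest critical frequency `ω₀`; the minimum is attained, see `isLeast_omega0`. -/
def omega0 : ℝ := sInf criticalSet

/-- The Hopf bifurcation value `β₀ = √(iω₀) sin (√(iω₀) π)` (about `5.6655`). -/
def beta0 : ℝ := (charFun omega0).re

lemma charFun_eq {ω : ℝ} (hω : 0 < ω) :
    (charFun ω).re = √(ω / 2) * (Real.sin (√(ω / 2) * Real.pi) * Real.cosh (√(ω / 2) * Real.pi)
        - Real.cos (√(ω / 2) * Real.pi) * Real.sinh (√(ω / 2) * Real.pi)) ∧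
    (charFun ω).im = √(ω / 2) * (Real.sin (√(ω / 2) * Real.pi) * Real.cosh (√(ω / 2) * Real.pi)
        + Real.cos (√(ω / 2) * Real.pi) * Real.sinh (√(ω / 2) * Real.pi)) := by
  have hs : Complex.sqrt (Complex.I * ω) = (√(ω / 2) : ℝ) + (√(ω / 2) : ℝ) * Complex.I := by
    rw [Complex.sqrt_eq_real_add_ite]
    have h1 : ‖Complex.I * (ω : ℂ)‖ = ω := by simp [abs_of_pos hω]
    have h2 : (Complex.I * (ω : ℂ)).re = 0 := by simp
    have h3 : (Complex.I * (ω : ℂ)).im = ω := by simp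
    rw [h1, h2, h3, if_pos hω.le]
    simp
  have hsin : Complex.sin (Complex.sqrt (Complex.I * ω) * Real.pi) =
      ((Real.sin (√(ω / 2) * Real.pi) * Real.cosh (√(ω / 2) * Real.pi) : ℝ) : ℂ) +
      ((Real.cos (√(ω / 2) * Real.pi) * Real.sinh (√(ω / 2) * Real.pi) : ℝ) : ℂ) * Complex.I := by
    have e : Complex.sqrt (Complex.I * ω) * Real.pi =
        ((√(ω / 2) * Real.pi : ℝ) : ℂ) + ((√(ω / 2) * Real.pi : ℝ) : ℂ) * Complex.I := by
      rw [hs]; push_cast; ring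
    rw [e, Complex.sin_add_mul_I]
    push_cast
    ring
  unfold charFun
  rw [hsin, hs]
  constructor
  · simp only [Complex.mul_re, Complex.add_re, Complex.add_im, Complex.ofReal_re,
      Complex.ofReal_im, Complex.I_re, Complex.I_im, Complex.mul_im]
    ring
  · simp only [Complex.mul_re, Complex.add_re, Complex.add_im, Complex.ofReal_re,
      Complex.ofReal_im, Complex.I_re, Complex.I_im, Complex.mul_im]
    ring

/-- The minimum that defines `ω₀` is attained. -/
theorem isLeast_omega0 : IsLeast criticalSet omega0 := by
  have hpi := Real.pi_pos
  set F : ℝ → ℝ := fun ω =>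
    Real.sin (√(ω / 2) * Real.pi) * Real.cosh (√(ω / 2) * Real.pi)
      + Real.cos (√(ω / 2) * Real.pi) * Real.sinh (√(ω / 2) * Real.pi) with hF
  have hFc : Continuous F := by
    have hc : Continuous fun ω : ℝ => √(ω / 2) * Real.pi := by fun_prop
    exact ((Real.continuous_sin.comp hc).mul (Real.continuous_cosh.comp hc)).add
      ((Real.continuous_cos.comp hc).mul (Real.continuous_sinh.comp hc))
  have hhalf : √((1 / 2 : ℝ) / 2) = 1 / 2 := by
    rw [show (1 / 2 : ℝ) / 2 = (1 / 2) ^ 2 by norm_num]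
    exact Real.sqrt_sq (by norm_num)
  have hone : √((2 : ℝ) / 2) = 1 := by norm_num
  have hF1 : 0 < F (1 / 2) := by
    simp only [hF, hhalf]
    rw [show (1 / 2 : ℝ) * Real.pi = Real.pi / 2 by ring, Real.sin_pi_div_two,
      Real.cos_pi_div_two]
    have := Real.cosh_pos (Real.pi / 2)
    linarith
  have hF2 : F 2 < 0 := by
    simp only [hF, hone, one_mul, Real.sin_pi, Real.cos_pi]
    have := Real.sinh_pos_iff.mpr hpi
    linarith
  have him : ∀ ω : ℝ, 0 < ω → ((charFun ω).im = 0 ↔ F ω = 0) := fun ω hω => by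
    rw [(charFun_eq hω).2]
    have : √(ω / 2) ≠ 0 := (Real.sqrt_pos.mpr (by linarith)).ne'
    rw [mul_eq_zero, or_iff_right this]
  -- below `1 / 2` there are no zeros
  have hlow : ∀ ω ∈ criticalSet, (1 / 2 : ℝ) ≤ ω := by
    rintro ω ⟨h0, h1, -⟩
    by_contra! hlt
    rw [him ω h0] at h1
    have hs0 : 0 < √(ω / 2) := Real.sqrt_pos.mpr (by linarith)
    have hs1 : √(ω / 2) < 1 / 2 := by
      rw [← hhalf]; exact Real.sqrt_lt_sqrt (by linarith) (by linarith)
    have hθ0 : 0 < √(ω / 2) * Real.pi := by positivity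
    have hθ1 : √(ω / 2) * Real.pi < Real.pi / 2 := by nlinarith
    have a1 := Real.sin_pos_of_pos_of_lt_pi hθ0 (by linarith)
    have a2 := Real.cos_pos_of_mem_Ioo ⟨by linarith, hθ1⟩
    have a3 := Real.sinh_pos_iff.mpr hθ0
    have a4 := Real.cosh_pos (√(ω / 2) * Real.pi)
    have : 0 < F ω := by simp only [hF]; positivity
    linarith
  have hmem : ∀ ω ∈ Icc (1 / 2 : ℝ) 2, F ω = 0 → ω ∈ criticalSet := by
    rintro ω ⟨hl, hu⟩ hz
    have h0 : 0 < ω := by linarith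
    have hne : ω ≠ 2 := by rintro rfl; linarith
    have hlt : ω < 2 := lt_of_le_of_ne hu hne
    refine ⟨h0, (him ω h0).mpr hz, ?_⟩
    rw [(charFun_eq h0).1]
    have hs0 : 0 < √(ω / 2) := Real.sqrt_pos.mpr (by linarith)
    have hs1 : √(ω / 2) < 1 := by
      rw [← hone]; exact Real.sqrt_lt_sqrt (by linarith) (by linarith)
    have a1 := Real.sin_pos_of_pos_of_lt_pi (x := √(ω / 2) * Real.pi) (by positivity)
      (by nlinarith)
    have a4 := Real.cosh_pos (√(ω / 2) * Real.pi)
    have a5 := mul_pos a1 a4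
    simp only [hF] at hz
    exact mul_pos hs0 (by linarith)
  obtain ⟨w, hw, hwz⟩ : ∃ w ∈ Icc (1 / 2 : ℝ) 2, F w = 0 := by
    have := intermediate_value_Icc' (by norm_num : (1 / 2 : ℝ) ≤ 2) hFc.continuousOn
    exact this ⟨hF2.le, hF1.le⟩
  have hK : IsCompact (Icc (1 / 2 : ℝ) 2 ∩ F ⁻¹' {0}) :=
    isCompact_Icc.inter_right (isClosed_singleton.preimage hFc)
  obtain ⟨m, ⟨hm, hmz⟩, hmin⟩ := hK.exists_isLeast ⟨w, hw, hwz⟩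
  have hleast : IsLeast criticalSet m := by
    refine ⟨hmem m hm hmz, fun ω hω => ?_⟩
    rcases le_total ω 2 with h | h
    · exact hmin ⟨⟨hlow ω hω, h⟩, (him ω hω.1).mp hω.2.1⟩
    · exact hm.2.trans h
  rw [omega0, hleast.csInf_eq]
  exact hleast

/-- `y` is a solution of the Volterra equation
`y(t) = f(t) + ∫₀ᵗ a(t - τ) tanh (β y(τ)) dτ`, `t > 0`. -/
def SolvesVolterra (β : ℝ) (u₀ y : ℝ → ℝ) : Prop :=
  ∀ t : ℝ, 0 < t →
    y t = forcing u₀ t + ∫ τ in (0 : ℝ)..t, kernel (t - τ) * Real.tanh (β * y τ)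

end

end Thermostat

namespace Thermostat

open MeasureTheory Set

/-! ### Power series along residue classes modulo four -/

/-! The proof is Popov's absolute stability criterion. Write χ for `charFun`, g = tanh(βy) and G(t)
= ∫₀ᵗ g. The cosecant expansion shows that 1/χ(ω) is the transfer function of the kernel at the
frequency ω. The criterion asks for q ≥ 0 with -Re χ + qω Im χ + |χ|²/β₀ ≥ 0 for every ω > 0
(`exists_popov_multiplier`).

In the variable x = π√(ω/2) this expression is, up to a positive factor, x³ times a power series in
x⁴. At the Hopf frequency it vanishes by the definition of β₀, and q is chosen so that its
derivative vanishes too. The coefficients from index two on are nonnegative, so the series lies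
above its tangent line at the double zero, and this line is zero (`popovFun_nonneg`).

The multiplier 1 + q d/dt is replaced by 1 + q(1 - translation by h)/h, because y is only
continuous. The error in the frequency condition is at most 2qh uniformly in ω, since |χ(ω)| ≥ ω².
Apply this operator to the equation, multiply by g and integrate over (0, T). The sector condition
gives gy ≥ g²/β; the difference quotient contributes a nonnegative amount, because the primitive of
tanh(β·) is convex; Fourier positivity bounds the remaining quadratic form below by -(1/β₀ +
2qh)∫g²; the limit -1/π of the kernel produces G(T)²/(2π), which absorbs the constant part of the
forcing. As 1/β > 1/β₀, a small h gives a bound on ∫₀ᵀ g² independent of T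
(`exists_integral_sq_tanh_le`).

Finally, the decaying part of the kernel convolved with g tends to zero, so y is asymptotic to the
Lipschitz function L - G/π, where L is the limit of the forcing. With g square integrable, y cannot
stay away from zero infinitely often (`tendsto_zero_of_integrable_sq_tanh`). -/

lemma hasSum_sinh_sub_sin (z : ℂ) :
    HasSum (fun n : ℕ => z ^ (4 * n + 3) / ((4 * n + 3).factorial : ℂ))
      ((Complex.sinh z - Complex.sin z) / 2) := by
  have h := ((Complex.hasSum_sinh z).sub (Complex.hasSum_sin z)).div_const 2
  have hi : Function.Injective fun m : ℕ => 2 * m + 1 := fun a b h => by simpa using h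
  rw [← hi.hasSum_iff] at h
  · refine h.congr_fun fun m => ?_
    simp only [Function.comp]
    rw [pow_succ (-1 : ℂ), pow_mul (-1 : ℂ)]
    ring_nf
  · intro n hn
    obtain ⟨k, rfl | rfl⟩ := Nat.even_or_odd' n
    · rw [pow_mul]; norm_num
    · exact absurd ⟨k, rfl⟩ hn

lemma hasSum_sinh_add_sin (z : ℂ) :
    HasSum (fun n : ℕ => z ^ (4 * n + 1) / ((4 * n + 1).factorial : ℂ))
      ((Complex.sinh z + Complex.sin z) / 2) := by
  have h := ((Complex.hasSum_sinh z).add (Complex.hasSum_sin z)).div_const 2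
  have hi : Function.Injective fun m : ℕ => 2 * m := fun a b h => by simpa using h
  rw [← hi.hasSum_iff] at h
  · refine h.congr_fun fun m => ?_
    simp only [Function.comp]
    rw [pow_mul (-1 : ℂ)]
    ring_nf
  · intro n hn
    obtain ⟨k, rfl | rfl⟩ := Nat.even_or_odd' n
    · exact absurd ⟨k, rfl⟩ hn
    · rw [pow_succ (-1 : ℂ), pow_mul]; norm_num; ring

lemma hasSum_cosh_sub_cos (z : ℂ) :
    HasSum (fun n : ℕ => z ^ (4 * n + 2) / ((4 * n + 2).factorial : ℂ))
      ((Complex.cosh z - Complex.cos z) / 2) := by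
  have h := ((Complex.hasSum_cosh z).sub (Complex.hasSum_cos z)).div_const 2
  have hi : Function.Injective fun m : ℕ => 2 * m + 1 := fun a b h => by simpa using h
  rw [← hi.hasSum_iff] at h
  · refine h.congr_fun fun m => ?_
    simp only [Function.comp]
    rw [pow_succ (-1 : ℂ), pow_mul (-1 : ℂ)]
    ring_nf
  · intro n hn
    obtain ⟨k, rfl | rfl⟩ := Nat.even_or_odd' n
    · rw [pow_mul]; norm_num
    · exact absurd ⟨k, rfl⟩ hn

lemma hasSum_cosh_add_cos (z : ℂ) :
    HasSum (fun n : ℕ => z ^ (4 * n) / ((4 * n).factorial : ℂ))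
      ((Complex.cosh z + Complex.cos z) / 2) := by
  have h := ((Complex.hasSum_cosh z).add (Complex.hasSum_cos z)).div_const 2
  have hi : Function.Injective fun m : ℕ => 2 * m := fun a b h => by simpa using h
  rw [← hi.hasSum_iff] at h
  · refine h.congr_fun fun m => ?_
    simp only [Function.comp]
    rw [pow_mul (-1 : ℂ)]
    ring_nf
  · intro n hn
    obtain ⟨k, rfl | rfl⟩ := Nat.even_or_odd' n
    · exact absurd ⟨k, rfl⟩ hn
    · rw [pow_succ (-1 : ℂ), pow_mul]; norm_num; ring

/-- Since (1 + i)⁴ = -4, the series along a residue class modulo four, evaluated at (1 + i)x, is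
real up to one fixed complex factor. Taking real or imaginary parts then yields the series of the
products of trigonometric and hyperbolic functions in `charFun`. -/
lemma one_add_I_mul_pow (x : ℝ) (n : ℕ) :
    ((1 + Complex.I) * x : ℂ) ^ (4 * n) = (((-4) ^ n * x ^ (4 * n) : ℝ) : ℂ) := by
  have : (1 + Complex.I) ^ 4 = (-4 : ℂ) := by
    rw [show (4 : ℕ) = 2 * 2 from rfl, pow_mul, add_sq, Complex.I_sq, one_pow]
    ring_nf; rw [Complex.I_sq]; norm_num
  rw [mul_pow, pow_mul, this]; push_cast; rfl

lemma sin_one_add_I_mul (x : ℝ) : Complex.sin ((1 + Complex.I) * x) =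
    ((Real.sin x * Real.cosh x : ℝ) : ℂ) + ((Real.cos x * Real.sinh x : ℝ) : ℂ) * Complex.I := by
  rw [show (1 + Complex.I) * (x : ℂ) = x + x * Complex.I by ring, Complex.sin_add_mul_I]
  push_cast; ring

lemma cos_one_add_I_mul (x : ℝ) : Complex.cos ((1 + Complex.I) * x) =
    ((Real.cos x * Real.cosh x : ℝ) : ℂ) - ((Real.sin x * Real.sinh x : ℝ) : ℂ) * Complex.I := by
  rw [show (1 + Complex.I) * (x : ℂ) = x + x * Complex.I by ring, Complex.cos_add_mul_I]
  push_cast; ring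

lemma sinh_one_add_I_mul (x : ℝ) : Complex.sinh ((1 + Complex.I) * x) =
    ((Real.cos x * Real.sinh x : ℝ) : ℂ) + ((Real.sin x * Real.cosh x : ℝ) : ℂ) * Complex.I := by
  rw [show (1 + Complex.I) * (x : ℂ) = x + x * Complex.I by ring, Complex.sinh_add,
    Complex.sinh_mul_I, Complex.cosh_mul_I]
  push_cast; ring

lemma cosh_one_add_I_mul (x : ℝ) : Complex.cosh ((1 + Complex.I) * x) =
    ((Real.cos x * Real.cosh x : ℝ) : ℂ) + ((Real.sin x * Real.sinh x : ℝ) : ℂ) * Complex.I := by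
  rw [show (1 + Complex.I) * (x : ℂ) = x + x * Complex.I by ring, Complex.cosh_add,
    Complex.sinh_mul_I, Complex.cosh_mul_I]
  push_cast; ring

lemma hasSum_sin_cosh_sub (x : ℝ) :
    HasSum (fun n : ℕ => 4 * (-4) ^ n * x ^ (4 * n + 3) / ((4 * n + 3).factorial : ℝ))
      (Real.sin x * Real.cosh x - Real.cos x * Real.sinh x) := by
  have h := (Complex.hasSum_re (hasSum_sinh_sub_sin ((1 + Complex.I) * x))).mul_left (-2)
  rw [sin_one_add_I_mul, sinh_one_add_I_mul] at h
  convert! h using 1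
  · funext n
    have e : (((1 + Complex.I) * x : ℂ)) ^ (4 * n + 3) / ((4 * n + 3).factorial : ℂ) =
        (((-4) ^ n * x ^ (4 * n) * x ^ 3 / ((4 * n + 3).factorial : ℝ) : ℝ) : ℂ) *
          (-2 + 2 * Complex.I) := by
      rw [pow_add, one_add_I_mul_pow, mul_pow,
        show (1 + Complex.I) ^ 3 = -2 + 2 * Complex.I by
          ring_nf; rw [show Complex.I ^ 3 = -Complex.I by rw [pow_succ, Complex.I_sq]; ring,
            Complex.I_sq]; ring]
      push_cast; ring
    rw [e, Complex.re_ofReal_mul]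
    simp; ring
  · simp [-Complex.ofReal_mul]; ring

lemma hasSum_sin_cosh_add (x : ℝ) :
    HasSum (fun n : ℕ => 2 * (-4) ^ n * x ^ (4 * n + 1) / ((4 * n + 1).factorial : ℝ))
      (Real.sin x * Real.cosh x + Real.cos x * Real.sinh x) := by
  have h := (Complex.hasSum_re (hasSum_sinh_add_sin ((1 + Complex.I) * x))).mul_left 2
  rw [sin_one_add_I_mul, sinh_one_add_I_mul] at h
  convert! h using 1
  · funext n
    have e : (((1 + Complex.I) * x : ℂ)) ^ (4 * n + 1) / ((4 * n + 1).factorial : ℂ) =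
        (((-4) ^ n * x ^ (4 * n) * x / ((4 * n + 1).factorial : ℝ) : ℝ) : ℂ) *
          (1 + Complex.I) := by
      rw [pow_add, one_add_I_mul_pow]
      push_cast; ring
    rw [e, Complex.re_ofReal_mul]
    simp; ring
  · simp [-Complex.ofReal_mul]; ring

lemma hasSum_sin_sinh (x : ℝ) :
    HasSum (fun n : ℕ => 4 * (-4) ^ n * x ^ (4 * n + 2) / ((4 * n + 2).factorial : ℝ))
      (2 * Real.sin x * Real.sinh x) := by
  have h := (Complex.hasSum_im (hasSum_cosh_sub_cos ((1 + Complex.I) * x))).mul_left 2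
  rw [cos_one_add_I_mul, cosh_one_add_I_mul] at h
  convert! h using 1
  · funext n
    have e : (((1 + Complex.I) * x : ℂ)) ^ (4 * n + 2) / ((4 * n + 2).factorial : ℂ) =
        (((-4) ^ n * x ^ (4 * n) * x ^ 2 / ((4 * n + 2).factorial : ℝ) : ℝ) : ℂ) *
          (2 * Complex.I) := by
      rw [pow_add, one_add_I_mul_pow, mul_pow,
        show (1 + Complex.I) ^ 2 = 2 * Complex.I by
          ring_nf; rw [Complex.I_sq]; ring]
      push_cast; ring
    rw [e, Complex.im_ofReal_mul]
    simp; ring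
  · simp [-Complex.ofReal_mul]; ring

lemma hasSum_cos_cosh (x : ℝ) :
    HasSum (fun n : ℕ => 2 * (-4) ^ n * x ^ (4 * n) / ((4 * n).factorial : ℝ))
      (2 * Real.cos x * Real.cosh x) := by
  have h := (Complex.hasSum_re (hasSum_cosh_add_cos ((1 + Complex.I) * x))).mul_left 2
  rw [cos_one_add_I_mul, cosh_one_add_I_mul] at h
  convert! h using 1
  · funext n
    have e : (((1 + Complex.I) * x : ℂ)) ^ (4 * n) / ((4 * n).factorial : ℂ) =
        (((-4) ^ n * x ^ (4 * n) / ((4 * n).factorial : ℝ) : ℝ) : ℂ) := by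
      rw [one_add_I_mul_pow]
      push_cast; ring
    rw [e, Complex.ofReal_re]
    ring
  · simp [-Complex.ofReal_mul]; ring

lemma hasSum_sin_sq_add_sinh_sq (x : ℝ) :
    HasSum (fun n : ℕ => 4 * 16 ^ n * x ^ (4 * n + 2) / ((4 * n + 2).factorial : ℝ))
      (Real.sin x ^ 2 + Real.sinh x ^ 2) := by
  have h := Complex.hasSum_re (hasSum_cosh_sub_cos ((2 * x : ℝ) : ℂ))
  convert! h using 1
  · funext n
    have : (((2 * x : ℝ) : ℂ)) ^ (4 * n + 2) / ((4 * n + 2).factorial : ℂ) =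
        (((2 * x) ^ (4 * n + 2) / ((4 * n + 2).factorial : ℝ) : ℝ) : ℂ) := by push_cast; rfl
    rw [this, Complex.ofReal_re, mul_pow, pow_add (2 : ℝ), pow_mul (2 : ℝ)]
    norm_num; ring
  · have : (Complex.cosh ((2 * x : ℝ) : ℂ) - Complex.cos ((2 * x : ℝ) : ℂ)) / 2 =
      (((Real.cosh (2 * x) - Real.cos (2 * x)) / 2 : ℝ) : ℂ) := by push_cast; rfl
    rw [this, Complex.ofReal_re, Real.cosh_two_mul, Real.cos_two_mul, Real.cosh_sq, Real.cos_sq']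
    ring

lemma hasSum_deriv_sin_sq_add_sinh_sq (x : ℝ) :
    HasSum (fun n : ℕ => 4 * 16 ^ n * x ^ (4 * n + 1) / ((4 * n + 1).factorial : ℝ))
      (2 * Real.sin x * Real.cos x + 2 * Real.sinh x * Real.cosh x) := by
  have h := (Complex.hasSum_re (hasSum_sinh_add_sin ((2 * x : ℝ) : ℂ))).mul_left 2
  convert! h using 1
  · funext n
    have : (((2 * x : ℝ) : ℂ)) ^ (4 * n + 1) / ((4 * n + 1).factorial : ℂ) =
        (((2 * x) ^ (4 * n + 1) / ((4 * n + 1).factorial : ℝ) : ℝ) : ℂ) := by push_cast; rfl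
    rw [this, Complex.ofReal_re, mul_pow, pow_add (2 : ℝ), pow_mul (2 : ℝ)]
    norm_num; ring
  · have : (Complex.sinh ((2 * x : ℝ) : ℂ) + Complex.sin ((2 * x : ℝ) : ℂ)) / 2 =
      (((Real.sinh (2 * x) + Real.sin (2 * x)) / 2 : ℝ) : ℂ) := by push_cast; rfl
    rw [this, Complex.ofReal_re, Real.sinh_two_mul, Real.sin_two_mul]
    ring

/-! ### The Popov inequality -/

lemma tangent_line_le_pow {v : ℝ} (hv : 0 ≤ v) (n : ℕ) : 1 + n * (v - 1) ≤ v ^ n := by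
  simpa using one_add_mul_le_pow (by linarith : -2 ≤ v - 1) n

/-- A power series whose coefficients beyond the linear one are nonnegative and which vanishes
to second order at `u₀ > 0` is nonnegative on the positive half line. -/
lemma HasSum.nonneg_of_double_zero {c : ℕ → ℝ} (hc : ∀ n, 2 ≤ n → 0 ≤ c n) {u u₀ p : ℝ}
    (hu : 0 ≤ u) (hu₀ : 0 < u₀) (h0 : HasSum (fun n => c n * u₀ ^ n) 0)
    (h1 : HasSum (fun n => n * c n * u₀ ^ n) 0) (hp : HasSum (fun n => c n * u ^ n) p) :
    0 ≤ p := by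
  -- Subtracting the tangent line at `u₀`, which is zero, cancels the terms of index 0 and 1; every
  -- other term is nonnegative by Bernoulli's inequality for `u / u₀`.
  have h := (hp.sub h0).sub (h1.mul_left (u / u₀ - 1))
  rw [mul_zero, sub_zero, sub_zero] at h
  refine h.nonneg fun n => ?_
  rcases Nat.lt_or_ge n 2 with hn | hn
  · interval_cases n
    · simp
    · apply le_of_eq; field_simp; push_cast; ring
  · have e : c n * u ^ n - c n * u₀ ^ n - (u / u₀ - 1) * (n * c n * u₀ ^ n) =
        c n * u₀ ^ n * ((u / u₀) ^ n - (1 + n * (u / u₀ - 1))) := by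
      rw [div_pow]; field_simp; ring
    rw [e]
    exact mul_nonneg (mul_nonneg (hc n hn) (by positivity))
      (sub_nonneg.mpr (tangent_line_le_pow (by positivity) n))

lemma linear_le_four_pow {n : ℕ} (hn : 3 ≤ n) : (18 : ℝ) * (4 * n + 2) ≤ 4 ^ (n + 1) := by
  induction n, hn using Nat.le_induction with
  | base => norm_num
  | succ k hk ih =>
    have : (3 : ℝ) ≤ k := by exact_mod_cast hk
    rw [pow_succ]; push_cast; linarith

/-- The coefficients of the expansion of the Popov function in powers `θ ^ (4 n + 3)`. -/
noncomputable def popovCoeff (κ μ : ℝ) (n : ℕ) : ℝ :=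
  -(4 * (-4) ^ n / ((4 * n + 3).factorial : ℝ)) + κ * (2 * (-4) ^ n / ((4 * n + 1).factorial : ℝ))
    + μ * (4 * 16 ^ n / ((4 * n + 2).factorial : ℝ))

/-- After a positive factor is removed, the sign alternates in all but the μ term. For even n the
only threat is -4, and 176 = 4³ · 11 / 4 is what n = 2 requires. For odd n the threat is the κ term,
and κ ≤ 9μ suffices because 18(4n + 2) ≤ 4ⁿ⁺¹ from n = 3 on. -/
lemma popovCoeff_nonneg {κ μ : ℝ} (hκ : 0 ≤ κ) (hκμ : κ ≤ 9 * μ) (hμ : 1 / 176 ≤ μ) {n : ℕ}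
    (hn : 2 ≤ n) : 0 ≤ popovCoeff κ μ n := by
  have f2 : ((4 * n + 2).factorial : ℝ) = (4 * n + 2) * ((4 * n + 1).factorial : ℝ) := by
    rw [Nat.factorial_succ]; push_cast; ring
  have f3 : ((4 * n + 3).factorial : ℝ) = (4 * n + 3) * ((4 * n + 2) * ((4 * n + 1).factorial : ℝ)) := by
    rw [Nat.factorial_succ, Nat.cast_mul, f2]; push_cast; ring
  have hF : (0 : ℝ) < ((4 * n + 1).factorial : ℝ) := by positivity
  have hn' : (2 : ℝ) ≤ n := by exact_mod_cast hn
  have e : popovCoeff κ μ n = 4 ^ n / ((4 * n + 3) * ((4 * n + 2) * ((4 * n + 1).factorial : ℝ))) *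
      ((-1) ^ n * (2 * κ * (4 * n + 2) * (4 * n + 3) - 4) + μ * 4 ^ (n + 1) * (4 * n + 3)) := by
    unfold popovCoeff
    rw [f3, f2, show (-4 : ℝ) ^ n = (-1) ^ n * 4 ^ n by rw [← mul_pow]; norm_num,
      show (16 : ℝ) ^ n = 4 ^ n * 4 ^ n by rw [← mul_pow]; norm_num]
    field_simp
    ring
  rw [e]
  refine mul_nonneg (by positivity) ?_
  rcases Nat.even_or_odd n with he | ho
  · rw [he.neg_one_pow]
    have h4 : (4 : ℝ) ^ 3 ≤ 4 ^ (n + 1) := pow_le_pow_right₀ (by norm_num) (by omega)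
    have h5 : 1 / 176 * 4 ^ 3 * (4 * 2 + 3) ≤ μ * 4 ^ (n + 1) * (4 * n + 3) := by gcongr
    have h6 : 0 ≤ 2 * κ * (4 * n + 2) * (4 * n + 3) := by positivity
    linarith
  · rw [ho.neg_one_pow]
    have h3 : 3 ≤ n := by
      rcases ho with ⟨k, rfl⟩; omega
    have h4 : 18 * (4 * n + 2) * μ ≤ 4 ^ (n + 1) * μ :=
      mul_le_mul_of_nonneg_right (linear_le_four_pow h3) (by linarith)
    have h5 : 2 * κ * (4 * n + 2) ≤ μ * 4 ^ (n + 1) := by nlinarith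
    have h6 := mul_le_mul_of_nonneg_right h5 (by positivity : (0 : ℝ) ≤ 4 * n + 3)
    linarith

/-- The function whose nonnegativity is the frequency condition of the Popov criterion. -/
noncomputable def popovFun (κ μ x : ℝ) : ℝ :=
  -(Real.sin x * Real.cosh x - Real.cos x * Real.sinh x)
    + κ * x ^ 2 * (Real.sin x * Real.cosh x + Real.cos x * Real.sinh x)
    + μ * x * (Real.sin x ^ 2 + Real.sinh x ^ 2)

lemma hasSum_popovFun (κ μ x : ℝ) :
    HasSum (fun n : ℕ => popovCoeff κ μ n * x ^ (4 * n + 3)) (popovFun κ μ x) := by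
  have h := ((hasSum_sin_cosh_sub x).neg.add ((hasSum_sin_cosh_add x).mul_left (κ * x ^ 2))).add
    ((hasSum_sin_sq_add_sinh_sq x).mul_left (μ * x))
  refine h.congr_fun fun n => ?_
  unfold popovCoeff
  ring

/-- The sum is x times the derivative of `popovFun`. It is assembled from known series, so no power
series has to be differentiated. -/
lemma hasSum_mul_deriv_popovFun (κ μ x : ℝ) :
    HasSum (fun n : ℕ => (4 * n + 3) * popovCoeff κ μ n * x ^ (4 * n + 3))
      (-(x * (2 * Real.sin x * Real.sinh x))
        + κ * (2 * x ^ 2 * (Real.sin x * Real.cosh x + Real.cos x * Real.sinh x)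
          + x ^ 3 * (2 * Real.cos x * Real.cosh x))
        + μ * (x * (Real.sin x ^ 2 + Real.sinh x ^ 2)
          + x ^ 2 * (2 * Real.sin x * Real.cos x + 2 * Real.sinh x * Real.cosh x))) := by
  have h := (((hasSum_sin_sinh x).mul_left x).neg.add
    ((((hasSum_sin_cosh_add x).mul_left (2 * x ^ 2)).add
      ((hasSum_cos_cosh x).mul_left (x ^ 3))).mul_left κ)).add
    ((((hasSum_sin_sq_add_sinh_sq x).mul_left x).add
      ((hasSum_deriv_sin_sq_add_sinh_sq x).mul_left (x ^ 2))).mul_left μ)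
  refine h.congr_fun fun n => ?_
  have f1 : ((4 * n + 1).factorial : ℝ) = (4 * n + 1) * ((4 * n).factorial : ℝ) := by
    rw [Nat.factorial_succ]; push_cast; ring
  have f2 : ((4 * n + 2).factorial : ℝ) = (4 * n + 2) * ((4 * n + 1) * ((4 * n).factorial : ℝ)) := by
    rw [Nat.factorial_succ, Nat.cast_mul, f1]; push_cast; ring
  have f3 : ((4 * n + 3).factorial : ℝ) =
      (4 * n + 3) * ((4 * n + 2) * ((4 * n + 1) * ((4 * n).factorial : ℝ))) := by
    rw [Nat.factorial_succ, Nat.cast_mul, f2]; push_cast; ring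
  have hF : ((4 * n).factorial : ℝ) ≠ 0 := by positivity
  have h1 : (4 * (n : ℝ) + 1) ≠ 0 := by positivity
  have h2 : (4 * (n : ℝ) + 2) ≠ 0 := by positivity
  have h3 : (4 * (n : ℝ) + 3) ≠ 0 := by positivity
  unfold popovCoeff
  rw [f3, f2, f1]
  field_simp
  ring

/-- The given μ makes the function vanish at `x₀`, and κ is solved from the vanishing of the
derivative there. Divided by x³ the function is a power series in x⁴, to which
`HasSum.nonneg_of_double_zero` applies. The numerical bounds on `x₀` serve only to check the
conditions on κ and μ in `popovCoeff_nonneg`. -/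
lemma popovFun_nonneg {x₀ : ℝ} (hx₀ : 47 / 20 ≤ x₀) (hx₀π : x₀ < Real.pi)
    (hB : Real.sin x₀ * Real.cosh x₀ + Real.cos x₀ * Real.sinh x₀ = 0) :
    ∃ κ : ℝ, 0 ≤ κ ∧ ∀ x : ℝ, 0 < x →
      0 ≤ popovFun κ (1 / (x₀ * Real.sin x₀ * Real.cosh x₀)) x := by
  have hx : 0 < x₀ := by linarith
  have hπ := Real.pi_lt_d2
  have hS : 0 < Real.sin x₀ := Real.sin_pos_of_pos_of_lt_pi hx hx₀π
  have hS1 := Real.sin_le_one x₀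
  have hSh : 0 < Real.sinh x₀ := Real.sinh_pos_iff.mpr hx
  have hCh : 0 < Real.cosh x₀ := Real.cosh_pos x₀
  have hlt : Real.sinh x₀ < Real.cosh x₀ := Real.sinh_lt_cosh x₀
  have hCh' : Real.cosh x₀ ≤ 25 / 2 := by
    have h1 : Real.exp x₀ ≤ 24 := by
      -- 63/20 exceeds π; the twentieth power reduces the estimate to integer powers of e.
      have e1 : Real.exp x₀ ≤ Real.exp (63 / 20) := Real.exp_le_exp.mpr (by linarith)
      have e2 : Real.exp (63 / 20) ^ 20 ≤ 24 ^ 20 := by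
        rw [← Real.exp_nat_mul, show ((20 : ℕ) : ℝ) * (63 / 20) = ((63 : ℕ) : ℝ) * 1 by norm_num,
          Real.exp_nat_mul]
        calc Real.exp 1 ^ 63 ≤ (2.7182818286 : ℝ) ^ 63 :=
              pow_le_pow_left₀ (Real.exp_pos _).le Real.exp_one_lt_d9.le _
          _ ≤ 24 ^ 20 := by norm_num
      exact e1.trans (le_of_pow_le_pow_left₀ (by norm_num) (by norm_num) e2)
    have h2 : Real.exp (-x₀) ≤ 1 := Real.exp_le_one_iff.mpr (by linarith)
    rw [Real.cosh_eq]; linarith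
  have hid := Real.cosh_sq x₀
  have hsc := Real.sin_sq_add_cos_sq x₀
  set S := Real.sin x₀
  set C := Real.cos x₀
  set H := Real.sinh x₀
  set K := Real.cosh x₀
  have hC : C = -(S * K / H) := by field_simp; linarith
  -- The left side always equals S²K² + C²H², and the two summands agree because SK = -CH at `x₀`.
  have hN : S ^ 2 + H ^ 2 = 2 * (S * K) ^ 2 := by
    have h1 : S ^ 2 * K ^ 2 = C ^ 2 * H ^ 2 := by
      rw [hC]; field_simp
    have h2 : S ^ 2 + H ^ 2 = S ^ 2 * K ^ 2 + C ^ 2 * H ^ 2 := by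
      rw [hid, show C ^ 2 = 1 - S ^ 2 by linarith]; ring
    rw [h2, ← h1]; ring
  set μ := 1 / (x₀ * S * K) with hμ
  set κ := H * (K + x₀ * H) / (x₀ ^ 3 * K ^ 2) with hκ
  have hκ0 : 0 ≤ κ := by positivity
  have hSK : x₀ * S * K ≤ 176 := by
    calc x₀ * S * K ≤ 4 * 1 * (25 / 2) := by gcongr; linarith
      _ ≤ 176 := by norm_num
  have hμ1 : 1 / 176 ≤ μ := one_div_le_one_div_of_le (by positivity) hSK
  have hκμ : κ ≤ 9 * μ := by
    rw [hκ, hμ, mul_one_div, div_le_div_iff₀ (by positivity) (by positivity)]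
    have h1 : H * (K + x₀ * H) ≤ K * (K + x₀ * K) := by gcongr
    have h2 : K * (1 + x₀) ≤ 9 * x₀ ^ 2 := by nlinarith
    calc H * (K + x₀ * H) * (x₀ * S * K) ≤ K * (K + x₀ * K) * (x₀ * 1 * K) := by gcongr
      _ = (K * (1 + x₀)) * (x₀ * K ^ 2) := by ring
      _ ≤ 9 * x₀ ^ 2 * (x₀ * K ^ 2) := by gcongr
      _ = 9 * (x₀ ^ 3 * K ^ 2) := by ring
  refine ⟨κ, hκ0, fun x hx' => ?_⟩
  have h0 := hasSum_popovFun κ μ x₀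
  have h1 := hasSum_mul_deriv_popovFun κ μ x₀
  have z0 : popovFun κ μ x₀ = 0 := by
    change -(S * K - C * H) + κ * x₀ ^ 2 * (S * K + C * H) + μ * x₀ * (S ^ 2 + H ^ 2) = 0
    rw [hN, hB, show C * H = -(S * K) by linarith, hμ]
    field_simp
    ring
  have z1 : -(x₀ * (2 * S * H)) + κ * (2 * x₀ ^ 2 * (S * K + C * H) + x₀ ^ 3 * (2 * C * K))
        + μ * (x₀ * (S ^ 2 + H ^ 2) + x₀ ^ 2 * (2 * S * C + 2 * H * K)) = 0 := by
    have a1 : κ * (x₀ ^ 3 * (2 * C * K)) = -(2 * S * (K + x₀ * H)) := by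
      rw [hκ, hC]; field_simp
    have a2 : μ * (x₀ * (2 * (S * K) ^ 2)) = 2 * (S * K) := by
      rw [hμ]; field_simp
    have a3 : μ * (x₀ ^ 2 * (2 * S * C + 2 * H * K)) = 4 * x₀ * S * H := by
      have h3 : H ^ 2 - S ^ 2 = 2 * S ^ 2 * H ^ 2 := by rw [mul_pow, hid] at hN; linarith
      calc μ * (x₀ ^ 2 * (2 * S * C + 2 * H * K)) = 2 * x₀ * ((H ^ 2 - S ^ 2) / (S * H)) := by
            rw [hμ, hC]; field_simp; ring
        _ = 4 * x₀ * S * H := by rw [h3]; field_simp; ring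
    rw [hB, hN, mul_zero, zero_add, a1, mul_add μ, a2, a3]
    ring
  rw [z0] at h0
  change HasSum _ (-(x₀ * (2 * S * H)) + κ * (2 * x₀ ^ 2 * (S * K + C * H) + x₀ ^ 3 * (2 * C * K))
        + μ * (x₀ * (S ^ 2 + H ^ 2) + x₀ ^ 2 * (2 * S * C + 2 * H * K))) at h1
  rw [z1] at h1
  have h2 := hasSum_popovFun κ μ x
  have hx3 : 0 < x ^ 3 := by positivity
  have key : 0 ≤ popovFun κ μ x / x ^ 3 := by
    refine HasSum.nonneg_of_double_zero (c := popovCoeff κ μ) (u := x ^ 4) (u₀ := x₀ ^ 4)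
      (fun n hn => popovCoeff_nonneg hκ0 hκμ hμ1 hn) (by positivity) (by positivity) ?_ ?_ ?_
    · have := h0.div_const (x₀ ^ 3)
      rw [zero_div] at this
      refine this.congr_fun fun n => ?_
      rw [pow_add, ← pow_mul]; field_simp
    · have := ((h1.sub (h0.mul_left 3)).div_const (x₀ ^ 3)).div_const 4
      rw [mul_zero, sub_zero, zero_div, zero_div] at this
      refine this.congr_fun fun n => ?_
      rw [pow_add, ← pow_mul]; field_simp; ring
    · refine (h2.div_const (x ^ 3)).congr_fun fun n => ?_
      rw [pow_add, ← pow_mul]; field_simp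
  have := mul_nonneg key hx3.le
  rwa [div_mul_cancel₀ _ hx3.ne'] at this

lemma normSq_charFun {ω : ℝ} (hω : 0 < ω) :
    Complex.normSq (charFun ω) = ω * (Real.sin (√(ω / 2) * Real.pi) ^ 2
      + Real.sinh (√(ω / 2) * Real.pi) ^ 2) := by
  have hr : √(ω / 2) * √(ω / 2) = ω / 2 := Real.mul_self_sqrt (by linarith)
  have hid := Real.cosh_sq (√(ω / 2) * Real.pi)
  have hsc := Real.cos_sq' (√(ω / 2) * Real.pi)
  rw [Complex.normSq_apply, (charFun_eq hω).1, (charFun_eq hω).2]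
  generalize Real.sin (√(ω / 2) * Real.pi) = S at *
  generalize Real.cos (√(ω / 2) * Real.pi) = C at *
  generalize Real.sinh (√(ω / 2) * Real.pi) = H at *
  generalize Real.cosh (√(ω / 2) * Real.pi) = K at *
  calc _ = (√(ω / 2) * √(ω / 2)) * (2 * (S ^ 2 * K ^ 2 + C ^ 2 * H ^ 2)) := by ring
    _ = _ := by rw [hr, hid, hsc]; ring

/-- Write the expression as sin x (cosh x - sinh x) + (sin x + cos x) sinh x; the second bracket is
a positive multiple of sin(x + π/4). -/
lemma sin_cosh_add_pos {x : ℝ} (hx : 0 < x) (hx' : x ≤ 3 * Real.pi / 4) :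
    0 < Real.sin x * Real.cosh x + Real.cos x * Real.sinh x := by
  have hπ := Real.pi_pos
  have hS : 0 < Real.sin x := Real.sin_pos_of_pos_of_lt_pi hx (by linarith)
  have hH := Real.sinh_pos_iff.mpr hx
  have hlt := Real.sinh_lt_cosh x
  have hsum : 0 ≤ Real.sin x + Real.cos x := by
    have h1 : 0 ≤ Real.sin (x + Real.pi / 4) :=
      Real.sin_nonneg_of_nonneg_of_le_pi (by linarith) (by linarith)
    rw [Real.sin_add, Real.sin_pi_div_four, Real.cos_pi_div_four] at h1
    have h2 : (0 : ℝ) < √2 / 2 := by positivity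
    nlinarith
  nlinarith

lemma omega0_pos : 0 < omega0 := isLeast_omega0.1.1

lemma beta0_pos : 0 < beta0 := isLeast_omega0.1.2.2

/-- Up to 3π/4 the imaginary part of `charFun` is positive. The intermediate value theorem gives a
zero before π, where the real part is positive, and minimality puts `omega0` at or below the
corresponding frequency. -/
lemma sqrt_omega0_bounds : 3 * Real.pi / 4 < √(omega0 / 2) * Real.pi ∧
    √(omega0 / 2) * Real.pi < Real.pi := by
  have hπ := Real.pi_pos
  have h0 := isLeast_omega0.1
  have hr : 0 < √(omega0 / 2) := Real.sqrt_pos.mpr (by linarith [omega0_pos])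
  constructor
  · by_contra! hle
    have h1 := sin_cosh_add_pos (mul_pos hr hπ) hle
    have h2 := h0.2.1
    rw [(charFun_eq h0.1).2] at h2
    exact (mul_pos hr h1).ne' h2
  · obtain ⟨x, ⟨hx1, hx2⟩, hx⟩ : ∃ x ∈ Icc (3 * Real.pi / 4) Real.pi,
        Real.sin x * Real.cosh x + Real.cos x * Real.sinh x = 0 := by
      have hc : ContinuousOn (fun x : ℝ => Real.sin x * Real.cosh x + Real.cos x * Real.sinh x)
          (Icc (3 * Real.pi / 4) Real.pi) := by fun_prop
      refine intermediate_value_Icc' (by linarith) hc ⟨?_, ?_⟩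
      · have := Real.sinh_pos_iff.mpr hπ
        simp only [Real.sin_pi, Real.cos_pi]; linarith
      · exact (sin_cosh_add_pos (by linarith) le_rfl).le
    have hx0 : 0 < x := by linarith
    have hxπ : x < Real.pi := by
      refine lt_of_le_of_ne hx2 fun h => ?_
      subst h
      have := Real.sinh_pos_iff.mpr hπ
      simp only [Real.sin_pi, Real.cos_pi] at hx; linarith
    have hs : √(2 * (x / Real.pi) ^ 2 / 2) = x / Real.pi := by
      rw [mul_div_cancel_left₀ _ two_ne_zero, Real.sqrt_sq (by positivity)]
    have hω : 0 < 2 * (x / Real.pi) ^ 2 := by positivity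
    have hmem : 2 * (x / Real.pi) ^ 2 ∈ criticalSet := by
      refine ⟨hω, ?_, ?_⟩
      · rw [(charFun_eq hω).2, hs, div_mul_cancel₀ _ hπ.ne', hx, mul_zero]
      · rw [(charFun_eq hω).1, hs, div_mul_cancel₀ _ hπ.ne']
        have h1 := Real.sin_pos_of_pos_of_lt_pi hx0 hxπ
        have h2 := Real.cosh_pos x
        have h3 := mul_pos h1 h2
        exact mul_pos (by positivity) (by linarith)
    have hle := isLeast_omega0.2 hmem
    have : √(omega0 / 2) ≤ x / Real.pi := by
      rw [← hs]; exact Real.sqrt_le_sqrt (by linarith)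
    calc √(omega0 / 2) * Real.pi ≤ x / Real.pi * Real.pi := by gcongr
      _ = x := div_mul_cancel₀ _ hπ.ne'
      _ < Real.pi := hxπ

/-- The frequency condition of the Popov criterion at the Hopf bifurcation value. -/
theorem exists_popov_multiplier : ∃ q : ℝ, 0 ≤ q ∧ ∀ ω : ℝ, 0 < ω →
    0 ≤ -(charFun ω).re + q * ω * (charFun ω).im + Complex.normSq (charFun ω) / beta0 := by
  have hπ := Real.pi_pos
  have hπ3 := Real.pi_gt_d2
  have h0 := isLeast_omega0.1
  have hr : 0 < √(omega0 / 2) := Real.sqrt_pos.mpr (by linarith [omega0_pos])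
  obtain ⟨hlo, hhi⟩ := sqrt_omega0_bounds
  have hB := h0.2.1
  have hβ : beta0 = (charFun omega0).re := rfl
  rw [(charFun_eq h0.1).2, mul_eq_zero, or_iff_right hr.ne'] at hB
  rw [(charFun_eq h0.1).1] at hβ
  obtain ⟨κ, hκ, hP⟩ := popovFun_nonneg (by linarith) hhi hB
  -- This identifies 1/β₀ with π/2 times the μ of `popovFun_nonneg`.
  have hβ' : beta0 = 2 / Real.pi * (√(omega0 / 2) * Real.pi *
      Real.sin (√(omega0 / 2) * Real.pi) * Real.cosh (√(omega0 / 2) * Real.pi)) := by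
    rw [hβ, show Real.cos (√(omega0 / 2) * Real.pi) * Real.sinh (√(omega0 / 2) * Real.pi) =
      -(Real.sin (√(omega0 / 2) * Real.pi) * Real.cosh (√(omega0 / 2) * Real.pi)) by linarith]
    field_simp; ring
  set m := √(omega0 / 2) * Real.pi *
      Real.sin (√(omega0 / 2) * Real.pi) * Real.cosh (√(omega0 / 2) * Real.pi) with hm
  have hm0 : 0 < m := by
    have := beta0_pos
    rw [hβ'] at this
    exact pos_of_mul_pos_right this (by positivity)
  -- With x = π√(ω/2) this choice makes qω equal to κx².
  refine ⟨κ * Real.pi ^ 2 / 2, by positivity, fun ω hω => ?_⟩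
  have hs : 0 < √(ω / 2) := Real.sqrt_pos.mpr (by linarith)
  have hss : √(ω / 2) ^ 2 = ω / 2 := Real.sq_sqrt (by linarith)
  have h1 := mul_nonneg hs.le (hP (√(ω / 2) * Real.pi) (by positivity))
  rw [normSq_charFun hω, (charFun_eq hω).1, (charFun_eq hω).2, hβ']
  unfold popovFun at h1
  have hω2 : ω = 2 * √(ω / 2) ^ 2 := by linarith
  convert! h1 using 1
  generalize √(ω / 2) = r at *
  subst hω2
  field_simp

/-- The characteristic function dominates the square of the frequency. -/
lemma sq_le_norm_charFun {ω : ℝ} (hω : 0 < ω) : ω ^ 2 ≤ ‖charFun ω‖ := by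
  have hs : 0 < √(ω / 2) := Real.sqrt_pos.mpr (by linarith)
  have hss : √(ω / 2) ^ 2 = ω / 2 := Real.sq_sqrt (by linarith)
  have hπ := Real.pi_gt_three
  have hsinh : ∀ x : ℝ, 0 ≤ x → x ^ 3 / 6 ≤ Real.sinh x := fun x hx => by
    have h := Real.hasSum_sinh x
    have := h.summable.sum_le_tsum {1} (fun i _ => by positivity)
    rw [h.tsum_eq] at this
    norm_num [Nat.factorial] at this
    exact this
  have h1 := hsinh (√(ω / 2) * Real.pi) (by positivity)
  have h2 : 4 * √(ω / 2) ^ 3 ≤ (√(ω / 2) * Real.pi) ^ 3 / 6 := by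
    have : (3 : ℝ) ^ 3 ≤ Real.pi ^ 3 := by gcongr
    rw [mul_pow]; nlinarith [pow_pos hs 3]
  rw [← sq_le_sq₀ (by positivity) (norm_nonneg _), Complex.sq_norm, normSq_charFun hω]
  have h3 : (4 * √(ω / 2) ^ 3) ^ 2 ≤ Real.sinh (√(ω / 2) * Real.pi) ^ 2 :=
    pow_le_pow_left₀ (by positivity) (h2.trans h1) 2
  have h4 : (4 * √(ω / 2) ^ 3) ^ 2 = 2 * ω ^ 3 := by
    rw [show (4 * √(ω / 2) ^ 3) ^ 2 = 16 * (√(ω / 2) ^ 2) ^ 3 by ring, hss]; ring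
  nlinarith [sq_nonneg (Real.sin (√(ω / 2) * Real.pi)), pow_pos hω 3]

/-! ### Quadratic forms of convolution operators -/

open Filter FourierTransform Convolution Topology in
-- Fourier inversion at the origin with Gaussian summation, so that `𝓕 f` need not be integrable.
-- Moving the transform onto the Gaussian turns the integral into an approximate identity applied to
-- f.
lemma tendsto_integral_cexp_smul_fourier {f : ℝ → ℂ} (hf : Integrable f)
    (h0 : ContinuousAt f 0) :
    Tendsto (fun c : ℝ => ∫ w : ℝ, Complex.exp (-(c : ℂ)⁻¹ * (‖w‖ : ℂ) ^ 2) • 𝓕 f w) atTop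
      (𝓝 (f 0)) := by
  refine (Real.tendsto_integral_gaussian_smul' hf h0).congr' ?_
  filter_upwards [Ioi_mem_atTop 0] with c (hc : 0 < c)
  have J : Integrable (fun w : ℝ => Complex.exp (-(c : ℂ)⁻¹ * (‖w‖ : ℂ) ^ 2
      + 2 * Real.pi * Complex.I * (inner ℝ (0 : ℝ) w : ℝ))) := by
    have := GaussianFourier.integrable_cexp_neg_mul_sq_norm_add (V := ℝ) (b := (c : ℂ)⁻¹)
      (by rw [← Complex.ofReal_inv, Complex.ofReal_re]; positivity) (2 * Real.pi * Complex.I) 0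
    exact this
  have h := VectorFourier.integral_fourierIntegral_smul_eq_flip (L := innerₗ ℝ)
      Real.continuous_fourierChar continuous_inner J hf
  have e1 : ∀ w : ℝ, VectorFourier.fourierIntegral Real.fourierChar volume (innerₗ ℝ)
      (fun w : ℝ => Complex.exp (-(c : ℂ)⁻¹ * (‖w‖ : ℂ) ^ 2
      + 2 * Real.pi * Complex.I * (inner ℝ (0 : ℝ) w : ℝ))) w =
      (Real.pi * c : ℂ) ^ (Module.finrank ℝ ℝ / 2 : ℂ) *
        Complex.exp (-Real.pi ^ 2 * c * ‖0 - w‖ ^ 2) := by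
    intro w
    have := fourier_gaussian_innerProductSpace' (V := ℝ) (b := (c : ℂ)⁻¹)
      (by rw [← Complex.ofReal_inv, Complex.ofReal_re]; positivity) 0 w
    refine this.trans ?_
    congr 1
    · simp
    · congr 1; simp; ring
  simp_rw [e1] at h
  rw [h]
  refine integral_congr_ae (Eventually.of_forall fun w => ?_)
  simp
  rfl

open Filter FourierTransform Convolution Topology in
lemma fourier_comp_neg_ofReal (γ : ℝ → ℝ) (ξ : ℝ) :
    𝓕 (fun t => ((γ (-t) : ℝ) : ℂ)) ξ = (starRingEnd ℂ) (𝓕 (fun t => ((γ t : ℝ) : ℂ)) ξ) := by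
  rw [Real.fourier_real_eq_integral_exp_smul, Real.fourier_real_eq_integral_exp_smul,
    ← integral_conj, ← integral_neg_eq_self]
  refine integral_congr_ae (Eventually.of_forall fun t => ?_)
  simp only [smul_eq_mul, map_mul, Complex.conj_ofReal, neg_neg, ← Complex.exp_conj, Complex.conj_I]
  congr 2
  push_cast; ring

open Filter FourierTransform Convolution Topology in
/-- If the real part of the Fourier transform of `K` is at least `-c`, the quadratic form of
convolution with `K` is bounded below by `-c` times the square of the `L²`-norm. -/
theorem quadForm_nonneg_of_continuous {K γ : ℝ → ℝ} (hK : Integrable K) (hγ : Continuous γ)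
    (hγs : HasCompactSupport γ) {c : ℝ}
    (hfreq : ∀ ξ : ℝ, ξ ≠ 0 → 0 ≤ (𝓕 (fun t => (K t : ℂ)) ξ).re + c) :
    0 ≤ (∫ t, γ t * ∫ τ, K τ * γ (t - τ)) + c * ∫ t, γ t ^ 2 := by
  set Kc : ℝ → ℂ := fun t => (K t : ℂ) with hKc
  set γc : ℝ → ℂ := fun t => (γ t : ℂ) with hγc
  set γr : ℝ → ℂ := fun t => ((γ (-t) : ℝ) : ℂ) with hγr
  have hKi : Integrable Kc := hK.ofReal
  have hγi : Integrable γc := (hγ.integrable_of_hasCompactSupport hγs).ofReal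
  have hγcc : Continuous γc := by fun_prop
  have hγcs : HasCompactSupport γc := hγs.comp_left Complex.ofReal_zero
  have hγrs : HasCompactSupport γr :=
    (hγs.comp_homeomorph (Homeomorph.neg ℝ)).comp_left Complex.ofReal_zero
  have hγrc : Continuous γr := by fun_prop
  have hγri : Integrable γr := hγrc.integrable_of_hasCompactSupport hγrs
  set V : ℝ → ℂ := Kc ⋆[ContinuousLinearMap.mul ℂ ℂ] γc with hV
  have hVi : Integrable V := hKi.integrable_convolution _ hγi
  have hVc : Continuous V :=
    hγcs.continuous_convolution_right _ hKi.locallyIntegrable hγcc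
  have hWi : Integrable (fun t => V t + (c : ℂ) * γc t) := hVi.add (hγi.const_mul _)
  -- Convolving with the reflection of γ makes f(0) the quadratic form and makes the transform (𝓕K +
  -- c)|𝓕γ|², whose real part is nonnegative away from frequency zero.
  set f : ℝ → ℂ := (fun t => V t + (c : ℂ) * γc t) ⋆[ContinuousLinearMap.mul ℂ ℂ] γr with hf
  have hfi : Integrable f := hWi.integrable_convolution _ hγri
  have hfc : Continuous f :=
    hγrs.continuous_convolution_right _ hWi.locallyIntegrable hγrc
  have hVr : ∀ t, V t = ((∫ τ, K τ * γ (t - τ) : ℝ) : ℂ) := fun t => by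
    rw [hV, convolution, ← integral_complex_ofReal]
    refine integral_congr_ae (Eventually.of_forall fun τ => ?_)
    simp [hKc, hγc]
  have hUc : Continuous fun t => ∫ τ, K τ * γ (t - τ) := by
    have : (fun t => ∫ τ, K τ * γ (t - τ)) = fun t => (V t).re := by
      funext t; rw [hVr, Complex.ofReal_re]
    rw [this]; exact Complex.continuous_re.comp hVc
  have hf0 : f 0 = (((∫ t, γ t * ∫ τ, K τ * γ (t - τ)) + c * ∫ t, γ t ^ 2 : ℝ) : ℂ) := by
    have i1 : Integrable fun t => γ t * ∫ τ, K τ * γ (t - τ) :=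
      (hγ.mul hUc).integrable_of_hasCompactSupport hγs.mul_right
    have i2 : Integrable fun t => γ t ^ 2 := by
      simp_rw [pow_two]
      exact (hγ.mul hγ).integrable_of_hasCompactSupport hγs.mul_right
    rw [← integral_const_mul, ← integral_add i1 (i2.const_mul c), ← integral_complex_ofReal, hf,
      convolution]
    refine integral_congr_ae (Eventually.of_forall fun t => ?_)
    simp only [ContinuousLinearMap.mul_apply', hVr, hγc, hγr, zero_sub, neg_neg]
    push_cast; ring
  have hFf : ∀ ξ, 𝓕 f ξ = (𝓕 Kc ξ + c) * ((‖𝓕 γc ξ‖ ^ 2 : ℝ) : ℂ) := fun ξ => by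
    rw [hf, Real.fourier_mul_convolution_eq hWi hγri, fourier_comp_neg_ofReal]
    have e : 𝓕 (fun t => V t + (c : ℂ) * γc t) ξ = 𝓕 V ξ + c * 𝓕 γc ξ := by
      have h1 := Real.fourierIntegral_convergent_iff (f := V) (μ := volume) ξ
      have h2 := Real.fourierIntegral_convergent_iff (f := γc) (μ := volume) ξ
      simp only [Real.fourier_eq]
      rw [← integral_const_mul, ← integral_add (h1.2 hVi) ((h2.2 hγi).const_mul _)]
      refine integral_congr_ae (Eventually.of_forall fun t => ?_)
      simp only [Circle.smul_def, smul_eq_mul]; ring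
    rw [e, hV, Real.fourier_mul_convolution_eq hKi hγi, ← add_mul, mul_assoc, Complex.mul_conj,
      Complex.normSq_eq_norm_sq]
  have hlim := (Complex.continuous_re.tendsto _).comp
    (tendsto_integral_cexp_smul_fourier hfi hfc.continuousAt)
  rw [hf0, Complex.ofReal_re] at hlim
  refine ge_of_tendsto' hlim fun b => ?_
  simp only [Function.comp]
  by_cases hint : Integrable fun w : ℝ => Complex.exp (-(b : ℂ)⁻¹ * (‖w‖ : ℂ) ^ 2) • 𝓕 f w
  · have := integral_re hint
    simp only [RCLike.re_to_complex] at this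
    rw [← this]
    refine integral_nonneg_of_ae ?_
    have hne : ∀ᵐ w : ℝ, w ≠ 0 := by simp [ae_iff]
    filter_upwards [hne] with w hw
    rw [hFf, smul_eq_mul, show Complex.exp (-(b : ℂ)⁻¹ * (‖w‖ : ℂ) ^ 2) =
        ((Real.exp (-b⁻¹ * ‖w‖ ^ 2) : ℝ) : ℂ) by push_cast; rfl, Complex.re_ofReal_mul,
      Complex.re_mul_ofReal, Complex.add_re, Complex.ofReal_re]
    exact mul_nonneg (Real.exp_pos _).le (mul_nonneg (hfreq w hw) (by positivity))
  -- A nonintegrable integrand has integral 0 by convention, which still satisfies the inequality.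
  · rw [integral_undef hint]; simp

lemma abs_integral_mul_comp_sub_le {K γ : ℝ → ℝ} (hK : Integrable K) {M : ℝ}
    (hγ : ∀ t, |γ t| ≤ M) (t : ℝ) : |∫ τ, K τ * γ (t - τ)| ≤ M * ∫ τ, |K τ| := by
  rw [← integral_const_mul, ← Real.norm_eq_abs]
  refine norm_integral_le_of_norm_le (hK.abs.const_mul M) (Filter.Eventually.of_forall fun τ => ?_)
  rw [Real.norm_eq_abs, abs_mul, mul_comm]
  exact mul_le_mul_of_nonneg_right (hγ _) (abs_nonneg _)

lemma continuous_integral_mul_comp_sub {K γ : ℝ → ℝ} (hK : Integrable K) (hγ : Continuous γ)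
    {M : ℝ} (hM : ∀ t, |γ t| ≤ M) : Continuous fun t => ∫ τ, K τ * γ (t - τ) := by
  refine continuous_of_dominated (bound := fun τ => M * |K τ|) (fun t => ?_) (fun t => ?_)
    (hK.abs.const_mul M) (Filter.Eventually.of_forall fun τ => by fun_prop)
  · exact hK.1.mul (by fun_prop : Continuous fun τ => γ (t - τ)).aestronglyMeasurable
  · refine Filter.Eventually.of_forall fun τ => ?_
    rw [Real.norm_eq_abs, abs_mul, mul_comm]
    exact mul_le_mul_of_nonneg_right (hM _) (abs_nonneg _)

/-- A continuous cutoff which vanishes near the endpoints of `(0, T)`. -/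
noncomputable def cutoff (T : ℝ) (n : ℕ) (t : ℝ) : ℝ :=
  max 0 (min 1 (min ((n + 1) * t - 1) ((n + 1) * (T - t) - 1)))

open FourierTransform in
/-- The bound of `quadForm_nonneg_of_continuous` for truncations to an interval of bounded
functions which are continuous in the interior. -/
theorem quadForm_nonneg {K g : ℝ → ℝ} (hK : Integrable K) (hg : ContinuousOn g (Ioi 0))
    (hg1 : ∀ t, |g t| ≤ 1) (T : ℝ) {c : ℝ}
    (hfreq : ∀ ξ : ℝ, ξ ≠ 0 → 0 ≤ (𝓕 (fun t => (K t : ℂ)) ξ).re + c) :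
    0 ≤ (∫ t, (Ioo 0 T).indicator g t * ∫ τ, K τ * (Ioo 0 T).indicator g (t - τ))
      + c * ∫ t, (Ioo 0 T).indicator g t ^ 2 := by
  -- The cutoff already vanishes for t ≤ 1/(n + 1); the maximum only keeps the argument of g away
  -- from 0, where g may be discontinuous.
  set γ : ℕ → ℝ → ℝ := fun n t => cutoff T n t * g (max t (1 / (n + 1))) with hγ
  have hn0 : ∀ n : ℕ, (0 : ℝ) < n + 1 := fun n => by positivity
  have hc0 : ∀ n t, t ∉ Ioo 0 T → cutoff T n t = 0 := fun n t ht => by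
    refine max_eq_left ((min_le_right _ _).trans ?_)
    have := hn0 n
    rcases le_or_gt t 0 with h | h
    · exact (min_le_left _ _).trans (by nlinarith)
    · have h2 : T ≤ t := by
        by_contra! h2; exact ht ⟨h, h2⟩
      exact (min_le_right _ _).trans (by nlinarith)
  have hc1 : ∀ n t, |cutoff T n t| ≤ 1 := fun n t => by
    rw [cutoff, abs_of_nonneg (le_max_left _ _)]
    exact max_le zero_le_one (min_le_left _ _)
  have hcc : ∀ n, Continuous (cutoff T n) := fun n => by unfold cutoff; fun_prop
  have hγ1 : ∀ n t, |γ n t| ≤ (Icc 0 T).indicator 1 t := fun n t => by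
    by_cases ht : t ∈ Icc 0 T
    · rw [indicator_of_mem ht, hγ, abs_mul]
      exact mul_le_one₀ (hc1 n t) (abs_nonneg _) (hg1 _)
    · rw [indicator_of_notMem ht, hγ]
      simp only
      rw [hc0 n t fun h => ht (Ioo_subset_Icc_self h), zero_mul, abs_zero]
  have hγ1' : ∀ n t, |γ n t| ≤ 1 := fun n t =>
    (hγ1 n t).trans (indicator_le_self' (fun _ _ => zero_le_one) t)
  have hγc : ∀ n, Continuous (γ n) := fun n => by
    refine (hcc n).mul (hg.comp_continuous (by fun_prop) fun t => ?_)
    exact lt_of_lt_of_le (one_div_pos.mpr (hn0 n)) (le_max_right _ _)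
  have hγs : ∀ n, HasCompactSupport (γ n) := fun n => by
    refine HasCompactSupport.intro (isCompact_Icc (a := (0 : ℝ)) (b := T)) fun t ht => ?_
    rw [hγ]; simp only
    rw [hc0 n t fun h => ht (Ioo_subset_Icc_self h), zero_mul]
  have hlim : ∀ t, Filter.Tendsto (fun n => γ n t) Filter.atTop
      (nhds ((Ioo 0 T).indicator g t)) := fun t => by
    by_cases ht : t ∈ Ioo 0 T
    · rw [indicator_of_mem ht]
      refine tendsto_const_nhds.congr' ?_
      have h1 : Filter.Tendsto (fun n : ℕ => ((n : ℝ) + 1)) Filter.atTop Filter.atTop :=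
        Filter.tendsto_atTop_add_const_right _ _ tendsto_natCast_atTop_atTop
      filter_upwards [h1.eventually_ge_atTop (2 / t), h1.eventually_ge_atTop (2 / (T - t))]
        with n hn1 hn2
      have ht0 := ht.1
      have htT : 0 < T - t := sub_pos.mpr ht.2
      rw [div_le_iff₀ ht0] at hn1
      rw [div_le_iff₀ htT] at hn2
      have e1 : cutoff T n t = 1 := by
        rw [cutoff, min_eq_left (le_min (by linarith) (by linarith)), max_eq_right zero_le_one]
      have e2 : max t (1 / ((n : ℝ) + 1)) = t := by
        refine max_eq_left ?_
        rw [div_le_iff₀ (hn0 n)]; linarith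
      simp only [hγ]
      rw [e1, e2, one_mul]
    · rw [indicator_of_notMem ht]
      refine tendsto_const_nhds.congr fun n => ?_
      simp only [hγ]
      rw [hc0 n t ht, zero_mul]
  have hind : Integrable ((Icc 0 T).indicator (1 : ℝ → ℝ)) :=
    (integrable_indicator_iff measurableSet_Icc).mpr
      (integrableOn_const (hs := isCompact_Icc.measure_lt_top.ne))
  have hconv : ∀ t, Filter.Tendsto (fun n => ∫ τ, K τ * γ n (t - τ)) Filter.atTop
      (nhds (∫ τ, K τ * (Ioo 0 T).indicator g (t - τ))) := fun t => by
    refine tendsto_integral_of_dominated_convergence (fun τ => |K τ|) (fun n => ?_) hK.abs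
      (fun n => ?_) ?_
    · exact hK.1.mul (by fun_prop : Continuous fun τ => γ n (t - τ)).aestronglyMeasurable
    · refine Filter.Eventually.of_forall fun τ => ?_
      rw [Real.norm_eq_abs, abs_mul]
      exact mul_le_of_le_one_right (abs_nonneg _) (hγ1' n _)
    · exact Filter.Eventually.of_forall fun τ => (hlim (t - τ)).const_mul _
  have l1 : Filter.Tendsto (fun n => ∫ t, γ n t * ∫ τ, K τ * γ n (t - τ)) Filter.atTop
      (nhds (∫ t, (Ioo 0 T).indicator g t * ∫ τ, K τ * (Ioo 0 T).indicator g (t - τ))) := by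
    refine tendsto_integral_of_dominated_convergence
      (fun t => (Icc 0 T).indicator 1 t * ∫ τ, |K τ|) (fun n => ?_) (hind.mul_const _)
      (fun n => ?_) ?_
    · exact ((hγc n).mul
        (continuous_integral_mul_comp_sub hK (hγc n) (hγ1' n))).aestronglyMeasurable
    · refine Filter.Eventually.of_forall fun t => ?_
      rw [Real.norm_eq_abs, abs_mul]
      refine mul_le_mul (hγ1 n t) ?_ (abs_nonneg _) ((abs_nonneg _).trans (hγ1 n t))
      simpa using abs_integral_mul_comp_sub_le hK (hγ1' n) t
    · exact Filter.Eventually.of_forall fun t => (hlim t).mul (hconv t)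
  have l2 : Filter.Tendsto (fun n => ∫ t, γ n t ^ 2) Filter.atTop
      (nhds (∫ t, (Ioo 0 T).indicator g t ^ 2)) := by
    refine tendsto_integral_of_dominated_convergence
      (fun t => (Icc 0 T).indicator 1 t) (fun n => ?_) hind (fun n => ?_) ?_
    · exact ((hγc n).pow 2).aestronglyMeasurable
    · refine Filter.Eventually.of_forall fun t => ?_
      rw [Real.norm_eq_abs, abs_pow, pow_two]
      exact (mul_le_of_le_one_right (abs_nonneg _) (hγ1' n t)).trans (hγ1 n t)
    · exact Filter.Eventually.of_forall fun t => (hlim t).pow 2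
  exact ge_of_tendsto' (l1.add (l2.const_mul c)) fun n =>
    quadForm_nonneg_of_continuous hK (hγc n) (hγs n) hfreq

/-! ### Partial fractions of the transfer function -/

lemma hasSum_cotTerm {x : ℂ} (hx : x ∈ Complex.integerComplement) :
    HasSum (cotTerm x) (Real.pi * Complex.cot (Real.pi * x) - 1 / x) := by
  rw [cot_series_rep' hx]
  exact (summable_cotTerm hx).hasSum

/-- The Mittag-Leffler expansion of the cosecant. -/
lemma hasSum_cosecant {x : ℂ} (hx : x ∈ Complex.integerComplement)
    (hx2 : x / 2 ∈ Complex.integerComplement) :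
    HasSum (fun n : ℕ => (-1) ^ (n + 1) * cotTerm x n)
      (Real.pi / Complex.sin (Real.pi * x) - 1 / x) := by
  have h1 := hasSum_cotTerm hx
  have h2 := hasSum_cotTerm hx2
  have hi : Function.Injective fun m : ℕ => 2 * m + 1 := fun a b h => by simpa using h
  -- The identity behind the proof is csc(πx) = cot(πx/2) - cot(πx). The poles of the first
  -- cotangent are the even integers, which `cotTerm` lists at odd indices.
  have h3 : HasSum (fun m : ℕ => if Even m then (0 : ℂ) else 2 * cotTerm x m)
      (Real.pi * Complex.cot (Real.pi * (x / 2)) - 1 / (x / 2)) := by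
    rw [← hi.hasSum_iff]
    · refine h2.congr_fun fun m => ?_
      have : ¬ Even (2 * m + 1) := by simp
      simp only [Function.comp, this, if_false, cotTerm]
      rw [show x / 2 - (m + 1) = (x - ((2 * m + 1 : ℕ) + 1)) / 2 by push_cast; ring,
        show x / 2 + (m + 1) = (x + ((2 * m + 1 : ℕ) + 1)) / 2 by push_cast; ring,
        one_div_div, one_div_div]
      ring
    · intro n hn
      rcases Nat.even_or_odd n with h | ⟨k, rfl⟩
      · simp [h]
      · exact absurd ⟨k, rfl⟩ hn
  have h4 := h3.sub h1
  have s1 := sin_pi_mul_ne_zero hx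
  have s2 := sin_pi_mul_ne_zero hx2
  have e : (Real.pi : ℂ) * x = 2 * (Real.pi * (x / 2)) := by ring
  have hx0 : x ≠ 0 := Complex.integerComplement.ne_zero hx
  convert! h4 using 1
  · funext n
    rcases Nat.even_or_odd n with h | h
    · rw [if_pos h, h.add_one.neg_one_pow]; ring
    · rw [if_neg (Nat.not_even_iff_odd.mpr h), h.add_one.neg_one_pow]; ring
  · rw [Complex.cot, Complex.cot, e]
    rw [e, Complex.sin_two_mul] at s1
    rw [Complex.sin_two_mul, Complex.cos_two_mul]
    generalize Complex.sin (Real.pi * (x / 2)) = S at *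
    generalize Complex.cos (Real.pi * (x / 2)) = C at *
    have hC : C ≠ 0 := right_ne_zero_of_mul s1
    field_simp
    ring

lemma sq_sqrt_I_mul {ω : ℝ} (hω : 0 < ω) :
    Complex.sqrt (Complex.I * ω) ^ 2 = Complex.I * ω := by
  rw [Complex.sqrt_eq_real_add_ite]
  have h1 : ‖Complex.I * (ω : ℂ)‖ = ω := by simp [abs_of_pos hω]
  have h2 : (Complex.I * (ω : ℂ)).re = 0 := by simp
  have h3 : (Complex.I * (ω : ℂ)).im = ω := by simp
  have h4 : (((√(ω / 2) : ℝ) : ℂ)) ^ 2 = ((ω / 2 : ℝ) : ℂ) := by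
    rw [← Complex.ofReal_pow, Real.sq_sqrt (by linarith)]
  rw [h1, h2, h3, if_pos hω.le, add_zero, sub_zero]
  ring_nf
  ring_nf at h4
  rw [Complex.I_sq, h4]
  push_cast; ring

lemma mem_integerComplement_of_sq_im_ne_zero {x : ℂ} (hx : (x ^ 2).im ≠ 0) :
    x ∈ Complex.integerComplement := by
  rintro ⟨n, rfl⟩
  exact hx (by norm_cast)

lemma charFun_ne_zero {ω : ℝ} (hω : 0 < ω) : charFun ω ≠ 0 := by
  rw [← norm_pos_iff]
  exact lt_of_lt_of_le (by positivity) (sq_le_norm_charFun hω)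

/-- Dividing the cosecant series at z = √(iω) by πz leaves a function of z² = iω alone: simple
fractions at the nonzero Neumann eigenvalues, while the eigenvalue zero gives the subtracted term.
-/
lemma hasSum_inv_charFun {ω : ℝ} (hω : 0 < ω) :
    HasSum (fun n : ℕ => (2 / Real.pi * (-1) ^ n / (((n : ℂ) + 1) ^ 2 - Complex.I * ω)))
      (1 / charFun ω - 1 / (Real.pi * (Complex.I * ω))) := by
  have hz2 := sq_sqrt_I_mul hω
  have hne := charFun_ne_zero hω
  unfold charFun at hne ⊢
  set z := Complex.sqrt (Complex.I * ω) with hz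
  have hm1 : z ∈ Complex.integerComplement :=
    mem_integerComplement_of_sq_im_ne_zero (by rw [hz2]; simpa using hω.ne')
  have hm2 : z / 2 ∈ Complex.integerComplement :=
    mem_integerComplement_of_sq_im_ne_zero (by
      rw [div_pow, hz2, show Complex.I * ω / 2 ^ 2 = ((ω / 4 : ℝ) : ℂ) * Complex.I by
        push_cast; ring]
      simpa using hω.ne')
  have hz0 : z ≠ 0 := Complex.integerComplement.ne_zero hm1
  have hπ : (Real.pi : ℂ) ≠ 0 := by exact_mod_cast Real.pi_ne_zero
  have h := (hasSum_cosecant hm1 hm2).mul_left (1 / (Real.pi * z))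
  rw [mul_comm (Real.pi : ℂ) z] at h
  convert! h using 1
  · funext n
    have h1 : z + (n + 1) ≠ 0 := by
      simpa using Complex.integerComplement_add_ne_zero hm1 ((n : ℤ) + 1)
    have h2 : z - (n + 1) ≠ 0 := by
      simpa [sub_eq_add_neg] using Complex.integerComplement_add_ne_zero hm1 (-(n + 1) : ℤ)
    have h3 : ((n : ℂ) + 1) ^ 2 - z ^ 2 ≠ 0 := by
      rw [show ((n : ℂ) + 1) ^ 2 - z ^ 2 = -((z + (n + 1)) * (z - (n + 1))) by ring]
      exact neg_ne_zero.mpr (mul_ne_zero h1 h2)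
    rw [cotTerm_identity hm1, ← hz2, pow_succ (-1 : ℂ)]
    rw [show (z + ((n : ℂ) + 1)) * (z - (n + 1)) = -(((n : ℂ) + 1) ^ 2 - z ^ 2) by ring]
    field_simp
  · rw [← hz2]
    have : Complex.sin (z * Real.pi) ≠ 0 := right_ne_zero_of_mul hne
    field_simp

/-! ### The exponentially decaying part of the kernel -/

/-- The kernel without its limit `-1 / π`, extended by zero to the left half line. -/
noncomputable def kernelTail (t : ℝ) : ℝ := if 0 < t then kernel t + 1 / Real.pi else 0

lemma kernelTail_of_pos {t : ℝ} (ht : 0 < t) : kernelTail t = kernel t + 1 / Real.pi := if_pos ht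

lemma kernelTail_of_nonpos {t : ℝ} (ht : t ≤ 0) : kernelTail t = 0 := if_neg ht.not_gt

lemma hasSum_kernelTail (t : ℝ) :
    HasSum (fun n : ℕ => (Ioi (0 : ℝ)).indicator
      (fun t => 2 / Real.pi * ((-1) ^ n * Real.exp (-((n : ℝ) + 1) ^ 2 * t))) t)
      (kernelTail t) := by
  rcases lt_or_ge 0 t with ht | ht
  · rw [kernelTail_of_pos ht]
    refine (hasSum_kernel ht).congr_fun fun n => ?_
    rw [indicator_of_mem (mem_Ioi.mpr ht), pow_add]
    norm_num
    ring
  · rw [kernelTail_of_nonpos ht]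
    have : ∀ n : ℕ, (Ioi (0 : ℝ)).indicator
      (fun t => 2 / Real.pi * ((-1) ^ n * Real.exp (-((n : ℝ) + 1) ^ 2 * t))) t = 0 := fun n =>
      indicator_of_notMem (by simpa using ht) _
    simp_rw [this]
    exact hasSum_zero

lemma measurable_kernelTail : Measurable kernelTail := by
  refine measurable_of_tendsto_metrizable (f := fun N t => ∑ n ∈ Finset.range N,
    (Ioi (0 : ℝ)).indicator
      (fun t => 2 / Real.pi * ((-1) ^ n * Real.exp (-((n : ℝ) + 1) ^ 2 * t))) t) (fun N => ?_) ?_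
  · refine Finset.measurable_sum _ fun n _ => ?_
    exact (by fun_prop : Continuous fun t : ℝ =>
      2 / Real.pi * ((-1) ^ n * Real.exp (-((n : ℝ) + 1) ^ 2 * t))).measurable.indicator
      measurableSet_Ioi
  · exact tendsto_pi_nhds.mpr fun t => (hasSum_kernelTail t).tendsto_sum_nat

/-- For t > 0 the series alternates with decreasing terms, so its sum lies between 0 and the first
term (2/π)e⁻ᵗ. Near t = 0 this gives a bound that absolute summation would miss. -/
lemma abs_kernelTail_le (t : ℝ) :
    |kernelTail t| ≤ (Ioi (0 : ℝ)).indicator (fun t => Real.exp (-t)) t := by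
  rcases lt_or_ge 0 t with ht | ht
  · rw [indicator_of_mem (mem_Ioi.mpr ht)]
    have h := (hasSum_kernelTail t).tendsto_sum_nat
    simp_rw [indicator_of_mem (mem_Ioi.mpr ht)] at h
    have h' := (h.const_mul (Real.pi / 2)).congr fun N => show _ =
        ∑ n ∈ Finset.range N, (-1) ^ n * Real.exp (-((n : ℝ) + 1) ^ 2 * t) by
      rw [Finset.mul_sum]
      refine Finset.sum_congr rfl fun n _ => ?_
      have := Real.pi_ne_zero
      field_simp
    have hanti : Antitone fun n : ℕ => Real.exp (-((n : ℝ) + 1) ^ 2 * t) := fun m n hmn => by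
      have hmn' : (m : ℝ) ≤ n := by exact_mod_cast hmn
      apply Real.exp_le_exp.mpr
      have : ((m : ℝ) + 1) ^ 2 ≤ ((n : ℝ) + 1) ^ 2 := by gcongr
      nlinarith
    have l := hanti.alternating_series_le_tendsto h' 0
    have u := hanti.tendsto_le_alternating_series h' 0
    norm_num at l u
    have hπ := Real.pi_gt_three
    have hl : 0 ≤ kernelTail t := nonneg_of_mul_nonneg_right l (by positivity)
    rw [abs_of_nonneg hl]
    nlinarith
  · rw [kernelTail_of_nonpos ht, abs_zero]
    exact indicator_nonneg (fun _ _ => (Real.exp_pos _).le) t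

lemma integrable_indicator_exp_neg :
    Integrable ((Ioi (0 : ℝ)).indicator fun t => Real.exp (-t)) := by
  rw [integrable_indicator_iff measurableSet_Ioi]
  simpa using exp_neg_integrableOn_Ioi 0 one_pos

lemma integrable_kernelTail : Integrable kernelTail :=
  integrable_indicator_exp_neg.mono' measurable_kernelTail.aestronglyMeasurable
    (Filter.Eventually.of_forall abs_kernelTail_le)

/-- The series may be integrated term by term because the L¹ norms of its terms, (2/π)/(n + 1)², are
summable; the resulting fractions are those of `hasSum_inv_charFun`. -/
lemma integral_exp_mul_kernelTail {ω : ℝ} (hω : 0 < ω) :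
    ∫ t : ℝ, Complex.exp (Complex.I * ω * t) * (kernelTail t : ℂ) =
      1 / charFun ω - 1 / (Real.pi * (Complex.I * ω)) := by
  set F : ℕ → ℝ → ℂ := fun n => (Ioi (0 : ℝ)).indicator fun t =>
    2 / Real.pi * (-1) ^ n * Complex.exp ((Complex.I * ω - ((n : ℂ) + 1) ^ 2) * t) with hF
  have hre : ∀ n : ℕ, (Complex.I * ω - ((n : ℂ) + 1) ^ 2).re = -((n : ℝ) + 1) ^ 2 := fun n => by
    rw [show Complex.I * ω - ((n : ℂ) + 1) ^ 2 =
      ((-((n : ℝ) + 1) ^ 2 : ℝ) : ℂ) + (ω : ℂ) * Complex.I by push_cast; ring]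
    simp [-Complex.ofReal_neg, -Complex.ofReal_pow, Complex.add_re]
  have hneg : ∀ n : ℕ, -((n : ℝ) + 1) ^ 2 < 0 := fun n => by
    have : (0 : ℝ) < n + 1 := by positivity
    nlinarith
  have hFi : ∀ n, Integrable (F n) := fun n => by
    rw [hF, integrable_indicator_iff measurableSet_Ioi]
    exact (integrableOn_exp_mul_complex_Ioi (by rw [hre]; exact hneg n) 0).const_mul _
  have hnorm : ∀ n t, ‖F n t‖ = (Ioi (0 : ℝ)).indicator
      (fun t => 2 / Real.pi * Real.exp (-((n : ℝ) + 1) ^ 2 * t)) t := fun n t => by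
    rw [hF, norm_indicator_eq_indicator_norm]
    congr 1
    funext t
    rw [norm_mul, norm_mul, norm_pow, norm_neg, norm_one, one_pow, mul_one, Complex.norm_exp,
      Complex.re_mul_ofReal, hre]
    congr 1
    rw [show (2 / Real.pi : ℂ) = ((2 / Real.pi : ℝ) : ℂ) by push_cast; rfl, Complex.norm_real,
      Real.norm_of_nonneg (by have := Real.pi_pos; positivity)]
  have hsum : Summable fun n => ∫ t, ‖F n t‖ := by
    have h1 : Summable fun n : ℕ => 2 / Real.pi * (1 / ((n : ℝ) + 1) ^ 2) := by
      refine Summable.mul_left _ ?_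
      have := (summable_nat_add_iff 1).mpr (Real.summable_one_div_nat_pow.mpr one_lt_two)
      simpa using this
    refine h1.congr fun n => ?_
    simp_rw [hnorm]
    rw [integral_indicator measurableSet_Ioi, integral_const_mul, integral_exp_mul_Ioi (hneg n)]
    have : (0 : ℝ) < n + 1 := by positivity
    simp
  have h := hasSum_integral_of_summable_integral_norm hFi hsum
  have e1 : ∀ t : ℝ, ∑' n, F n t = Complex.exp (Complex.I * ω * t) * kernelTail t := fun t => by
    have h1 := (Complex.hasSum_ofReal.mpr (hasSum_kernelTail t)).mul_left
      (Complex.exp (Complex.I * ω * t))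
    rw [← h1.tsum_eq]
    refine tsum_congr fun n => ?_
    by_cases ht : t ∈ Ioi (0 : ℝ)
    · rw [hF]
      simp only [indicator_of_mem ht]
      push_cast
      rw [sub_mul, sub_eq_add_neg, Complex.exp_add]
      ring_nf
    · rw [hF]
      simp only [indicator_of_notMem ht]
      simp
  have e2 : ∀ n, ∫ t, F n t = 2 / Real.pi * (-1) ^ n / (((n : ℂ) + 1) ^ 2 - Complex.I * ω) :=
    fun n => by
      rw [hF, integral_indicator measurableSet_Ioi, integral_const_mul,
        integral_exp_mul_complex_Ioi (by rw [hre]; exact hneg n)]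
      rw [← neg_sub, div_neg]
      simp
      ring
  simp_rw [e1, e2] at h
  exact h.unique (hasSum_inv_charFun hω)

/-! ### The kernel of the Popov functional -/

/-- The integrable part of the kernel obtained by applying `1 + q (1 - translation by h) / h`
to minus the kernel of the Volterra equation. -/
noncomputable def popovKernel (q h t : ℝ) : ℝ :=
  -kernelTail t - q / h * (kernelTail t - kernelTail (t - h)
    - 1 / Real.pi * (Ioc 0 h).indicator 1 t)

lemma integrable_indicator_Ioc_one (h : ℝ) : Integrable ((Ioc 0 h).indicator (1 : ℝ → ℝ)) :=
  (integrable_indicator_iff measurableSet_Ioc).mpr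
    (integrableOn_const (hs := measure_Ioc_lt_top.ne))

lemma integrable_popovKernel (q h : ℝ) : Integrable (popovKernel q h) :=
  integrable_kernelTail.neg.sub (((integrable_kernelTail.sub
    (integrable_kernelTail.comp_sub_right h)).sub
      ((integrable_indicator_Ioc_one h).const_mul _)).const_mul _)

lemma integrable_exp_I_mul {K : ℝ → ℝ} (hK : Integrable K) (ω : ℝ) :
    Integrable fun t : ℝ => Complex.exp (Complex.I * ω * t) * (K t : ℂ) := by
  refine hK.ofReal.bdd_mul (c := 1) (by fun_prop) (Filter.Eventually.of_forall fun t => ?_)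
  rw [show Complex.I * (ω : ℂ) * t = ((ω * t : ℝ) : ℂ) * Complex.I by push_cast; ring,
    Complex.norm_exp_ofReal_mul_I]

/-- The only trace of the nonintegrable constant -1/π is the term 1/(πiω). It is purely imaginary
and so does not enter the frequency condition. -/
lemma integral_exp_mul_popovKernel {q h ω : ℝ} (hh : 0 < h) (hω : 0 < ω) :
    ∫ t : ℝ, Complex.exp (Complex.I * ω * t) * (popovKernel q h t : ℂ) =
      1 / (Real.pi * (Complex.I * ω))
        - (1 + q / h * (1 - Complex.exp (Complex.I * ω * h))) / charFun ω := by
  have i1 := integrable_exp_I_mul integrable_kernelTail ω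
  have i2 := integrable_exp_I_mul (integrable_kernelTail.comp_sub_right h) ω
  have i3 := integrable_exp_I_mul (integrable_indicator_Ioc_one h) ω
  have hω0 : Complex.I * (ω : ℂ) ≠ 0 := mul_ne_zero Complex.I_ne_zero (by exact_mod_cast hω.ne')
  have hπ : (Real.pi : ℂ) ≠ 0 := by exact_mod_cast Real.pi_ne_zero
  have e1 := integral_exp_mul_kernelTail hω
  have e2 : ∫ t : ℝ, Complex.exp (Complex.I * ω * t) * (kernelTail (t - h) : ℂ) =
      Complex.exp (Complex.I * ω * h) * (1 / charFun ω - 1 / (Real.pi * (Complex.I * ω))) := by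
    rw [← e1, ← integral_const_mul, ← integral_add_right_eq_self _ h]
    refine integral_congr_ae (Filter.Eventually.of_forall fun t => ?_)
    simp only [add_sub_cancel_right]
    push_cast
    rw [mul_add, Complex.exp_add]; ring
  have e3 : ∫ t : ℝ, Complex.exp (Complex.I * ω * t) * (((Ioc 0 h).indicator (1 : ℝ → ℝ) t : ℝ) : ℂ)
      = (Complex.exp (Complex.I * ω * h) - 1) / (Complex.I * ω) := by
    have : ∀ t : ℝ, Complex.exp (Complex.I * ω * t) * (((Ioc 0 h).indicator (1 : ℝ → ℝ) t : ℝ) : ℂ)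
        = (Ioc 0 h).indicator (fun t : ℝ => Complex.exp (Complex.I * ω * t)) t := fun t => by
      by_cases ht : t ∈ Ioc 0 h
      · simp only [indicator_of_mem ht]; simp
      · simp only [indicator_of_notMem ht]; simp
    simp_rw [this]
    rw [integral_indicator measurableSet_Ioc, ← intervalIntegral.integral_of_le hh.le,
      integral_exp_mul_complex hω0]
    simp
  have e : ∀ t : ℝ, Complex.exp (Complex.I * ω * t) * (popovKernel q h t : ℂ) =
      -(Complex.exp (Complex.I * ω * t) * (kernelTail t : ℂ)) - (q / h : ℂ) *
        (Complex.exp (Complex.I * ω * t) * (kernelTail t : ℂ)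
          - Complex.exp (Complex.I * ω * t) * (kernelTail (t - h) : ℂ)
          - (1 / Real.pi : ℂ) * (Complex.exp (Complex.I * ω * t) *
            (((Ioc 0 h).indicator (1 : ℝ → ℝ) t : ℝ) : ℂ))) := fun t => by
    unfold popovKernel; push_cast; ring
  simp_rw [e]
  rw [integral_sub (by exact i1.neg) (by exact ((i1.sub i2).sub (i3.const_mul _)).const_mul _),
    integral_neg, integral_const_mul, integral_sub (by exact i1.sub i2) (by exact i3.const_mul _),
    integral_sub i1 i2, integral_const_mul, e1, e2, e3]
  have hc := charFun_ne_zero hω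
  have hh' : (h : ℂ) ≠ 0 := by exact_mod_cast hh.ne'
  field_simp
  ring

lemma norm_exp_I_sub_le (x : ℝ) : ‖Complex.exp (Complex.I * x) - 1 - Complex.I * x‖ ≤ 2 * x ^ 2 := by
  have hn : ‖Complex.I * (x : ℂ)‖ = |x| := by simp
  rcases le_or_gt |x| 1 with h | h
  · have := Complex.norm_exp_sub_one_sub_id_le (x := Complex.I * x) (by rw [hn]; exact h)
    rw [hn, sq_abs] at this
    nlinarith [sq_nonneg x]
  · calc _ ≤ ‖Complex.exp (Complex.I * x) - 1‖ + ‖Complex.I * (x : ℂ)‖ := norm_sub_le _ _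
      _ ≤ |x| + |x| := add_le_add (Real.norm_exp_I_mul_ofReal_sub_one_le) hn.le
      _ ≤ 2 * |x| ^ 2 := by nlinarith
      _ = 2 * x ^ 2 := by rw [sq_abs]

/-- Replacing (1 - exp(iωh))/h by -iω costs at most 2hω², and division by |χ(ω)| ≥ ω² makes the loss
2qh uniform in the frequency. What remains is the Popov inequality divided by |χ|². -/
lemma re_integral_popovKernel_ge {q h ω : ℝ} (hq : 0 ≤ q) (hh : 0 < h) (hω : 0 < ω)
    (hpop : 0 ≤ -(charFun ω).re + q * ω * (charFun ω).im + Complex.normSq (charFun ω) / beta0) :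
    0 ≤ (∫ t : ℝ, Complex.exp (Complex.I * ω * t) * (popovKernel q h t : ℂ)).re
      + (1 / beta0 + 2 * q * h) := by
  rw [integral_exp_mul_popovKernel hh hω]
  have hc := charFun_ne_zero hω
  have hcn : 0 < ‖charFun ω‖ := norm_pos_iff.mpr hc
  have hh' : (h : ℂ) ≠ 0 := by exact_mod_cast hh.ne'
  have e : 1 / (Real.pi * (Complex.I * ω))
        - (1 + q / h * (1 - Complex.exp (Complex.I * ω * h))) / charFun ω =
      ((-(1 / (Real.pi * ω)) : ℝ) : ℂ) * Complex.I
      + -((1 - ((q * ω : ℝ) : ℂ) * Complex.I) / charFun ω)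
      + ((q / h : ℝ) : ℂ) * ((Complex.exp (Complex.I * (ω * h : ℝ)) - 1
        - Complex.I * (ω * h : ℝ)) / charFun ω) := by
    have hω' : (ω : ℂ) ≠ 0 := by exact_mod_cast hω.ne'
    have hπ : (Real.pi : ℂ) ≠ 0 := by exact_mod_cast Real.pi_ne_zero
    have hI := Complex.I_ne_zero
    have : 1 / (Real.pi * (Complex.I * ω)) = ((-(1 / (Real.pi * ω)) : ℝ) : ℂ) * Complex.I := by
      push_cast
      field_simp
      rw [Complex.I_sq, neg_neg]
    rw [this, add_assoc, sub_eq_add_neg]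
    congr 1
    push_cast
    rw [mul_assoc Complex.I]
    field_simp
    ring
  rw [e, Complex.add_re, Complex.add_re]
  have r1 : (((-(1 / (Real.pi * ω)) : ℝ) : ℂ) * Complex.I).re = 0 := by
    rw [Complex.re_ofReal_mul, Complex.I_re, mul_zero]
  have r2 : -(1 / beta0) ≤ (-((1 - ((q * ω : ℝ) : ℂ) * Complex.I) / charFun ω)).re := by
    have hns : 0 < Complex.normSq (charFun ω) := Complex.normSq_pos.mpr hc
    have : (-((1 - ((q * ω : ℝ) : ℂ) * Complex.I) / charFun ω)).re =
        (-(charFun ω).re + q * ω * (charFun ω).im) / Complex.normSq (charFun ω) := by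
      rw [Complex.neg_re, Complex.div_re]
      simp [-Complex.ofReal_mul]
      ring
    rw [this, le_div_iff₀ hns]
    have h2 : -(1 / beta0) * Complex.normSq (charFun ω) =
      -(Complex.normSq (charFun ω) / beta0) := by ring
    linarith
  have r3 : -(2 * q * h) ≤ (((q / h : ℝ) : ℂ) * ((Complex.exp (Complex.I * (ω * h : ℝ)) - 1
        - Complex.I * (ω * h : ℝ)) / charFun ω)).re := by
    refine (abs_le.mp ((Complex.abs_re_le_norm _).trans ?_)).1
    rw [norm_mul, norm_div, Complex.norm_real, Real.norm_of_nonneg (by positivity)]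
    have h1 := norm_exp_I_sub_le (ω * h)
    have h2 := sq_le_norm_charFun hω
    calc q / h * (_ / ‖charFun ω‖) ≤ q / h * (2 * (ω * h) ^ 2 / ‖charFun ω‖) := by gcongr
      _ = 2 * q * h * (ω ^ 2 / ‖charFun ω‖) := by field_simp
      _ ≤ 2 * q * h * 1 := by
        gcongr
        exact (div_le_one hcn).mpr h2
      _ = 2 * q * h := mul_one _
  linarith

open FourierTransform in
/-- The frequency condition for the integrable part of the Popov kernel. -/
theorem exists_popovKernel_frequency : ∃ q : ℝ, 0 ≤ q ∧ ∀ h : ℝ, 0 < h → ∀ ξ : ℝ, ξ ≠ 0 →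
    0 ≤ (𝓕 (fun t => (popovKernel q h t : ℂ)) ξ).re + (1 / beta0 + 2 * q * h) := by
  obtain ⟨q, hq, hpop⟩ := exists_popov_multiplier
  refine ⟨q, hq, fun h hh ξ hξ => ?_⟩
  -- The exponent convention makes ω = -2πη, so negative η are treated directly and positive η by
  -- conjugation.
  have hF : ∀ η : ℝ, 𝓕 (fun t => (popovKernel q h t : ℂ)) η =
      ∫ t : ℝ, Complex.exp (Complex.I * ((-(2 * Real.pi * η) : ℝ) : ℂ) * t) *
        (popovKernel q h t : ℂ) := fun η => by
    rw [Real.fourier_real_eq_integral_exp_smul]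
    refine integral_congr_ae (Filter.Eventually.of_forall fun t => ?_)
    simp only [smul_eq_mul]
    congr 2
    push_cast; ring
  have hneg : ∀ η : ℝ, η < 0 → 0 ≤ (𝓕 (fun t => (popovKernel q h t : ℂ)) η).re
      + (1 / beta0 + 2 * q * h) := fun η hη => by
    have hω : 0 < -(2 * Real.pi * η) := by
      have := mul_pos Real.two_pi_pos (neg_pos.mpr hη); linarith
    rw [hF]
    exact re_integral_popovKernel_ge hq hh hω (hpop _ hω)
  rcases lt_or_gt_of_ne hξ with hlt | hgt
  · exact hneg ξ hlt
  · have := hneg (-ξ) (by linarith)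
    have e : 𝓕 (fun t => (popovKernel q h t : ℂ)) ξ =
        (starRingEnd ℂ) (𝓕 (fun t => (popovKernel q h t : ℂ)) (-ξ)) := by
      rw [hF, hF, ← integral_conj]
      refine integral_congr_ae (Filter.Eventually.of_forall fun t => ?_)
      simp only [map_mul, Complex.conj_ofReal, ← Complex.exp_conj, Complex.conj_I]
      congr 2
      push_cast; ring
    rwa [e, Complex.conj_re]

/-! ### The hyperbolic tangent and its primitive -/

lemma continuous_tanh : Continuous Real.tanh := by
  have : Real.tanh = fun x => Real.sinh x / Real.cosh x := funext Real.tanh_eq_sinh_div_cosh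
  rw [this]
  exact Real.continuous_sinh.div Real.continuous_cosh fun x => (Real.cosh_pos x).ne'

lemma tanh_mono : Monotone Real.tanh := fun x y hxy => by
  rw [Real.tanh_eq_sinh_div_cosh, Real.tanh_eq_sinh_div_cosh,
    div_le_div_iff₀ (Real.cosh_pos x) (Real.cosh_pos y)]
  have h : 0 ≤ Real.sinh (y - x) := Real.sinh_nonneg_iff.mpr (by linarith)
  rw [Real.sinh_sub] at h
  linarith

lemma abs_tanh_le_one (x : ℝ) : |Real.tanh x| ≤ 1 := (Real.abs_tanh_lt_one x).le

lemma tanh_nonneg {x : ℝ} (hx : 0 ≤ x) : 0 ≤ Real.tanh x := by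
  simpa using tanh_mono hx

lemma tanh_le_self {x : ℝ} (hx : 0 ≤ x) : Real.tanh x ≤ x := by
  have hm : MonotoneOn (fun x => x * Real.cosh x - Real.sinh x) (Ici 0) := by
    refine monotoneOn_of_deriv_nonneg (convex_Ici 0) (by fun_prop) (by fun_prop) fun z hz => ?_
    rw [interior_Ici] at hz
    have h : HasDerivAt (fun x => x * Real.cosh x - Real.sinh x)
        (1 * Real.cosh z + z * Real.sinh z - Real.cosh z) z :=
      ((hasDerivAt_id z).mul (Real.hasDerivAt_cosh z)).sub (Real.hasDerivAt_sinh z)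
    rw [h.deriv]
    have := mul_nonneg (le_of_lt hz) (Real.sinh_nonneg_iff.mpr (le_of_lt hz))
    linarith
  have := hm (mem_Ici.mpr le_rfl) (mem_Ici.mpr hx) hx
  simp only [zero_mul, Real.sinh_zero, sub_zero] at this
  rw [Real.tanh_eq_sinh_div_cosh, div_le_iff₀ (Real.cosh_pos x)]
  linarith

/-- The sector condition on the feedback: at x = βy it reads g²/β ≤ gy. -/
lemma sq_tanh_le (x : ℝ) : Real.tanh x ^ 2 ≤ Real.tanh x * x := by
  rcases le_total 0 x with h | h
  · rw [pow_two]; exact mul_le_mul_of_nonneg_left (tanh_le_self h) (tanh_nonneg h)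
  · have h' := neg_nonneg.mpr h
    have h1 := tanh_le_self h'
    have h2 := tanh_nonneg h'
    rw [Real.tanh_neg] at h1 h2
    nlinarith

/-- The primitive of `tanh (β ·)` which vanishes at the origin. -/
noncomputable def tanhPrimitive (β v : ℝ) : ℝ := ∫ s in (0 : ℝ)..v, Real.tanh (β * s)

lemma continuous_tanhPrimitive (β : ℝ) : Continuous (tanhPrimitive β) :=
  intervalIntegral.continuous_primitive
    (fun _ _ => (continuous_tanh.comp (by fun_prop)).intervalIntegrable _ _) 0

lemma tanhPrimitive_zero (β : ℝ) : tanhPrimitive β 0 = 0 := intervalIntegral.integral_same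

/-- The primitive is convex because its derivative is monotone. This tangent inequality replaces the
chain rule when dy/dt is replaced by a difference quotient. -/
lemma tanhPrimitive_sub_le {β : ℝ} (hβ : 0 ≤ β) (v w : ℝ) :
    tanhPrimitive β v - tanhPrimitive β w ≤ Real.tanh (β * v) * (v - w) := by
  have hi : ∀ a b : ℝ, IntervalIntegrable (fun s => Real.tanh (β * s)) volume a b := fun _ _ =>
    (continuous_tanh.comp (by fun_prop)).intervalIntegrable _ _
  rw [tanhPrimitive, tanhPrimitive, intervalIntegral.integral_interval_sub_left (hi _ _) (hi _ _)]
  rcases le_total w v with h | h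
  · calc ∫ s in w..v, Real.tanh (β * s) ≤ ∫ _ in w..v, Real.tanh (β * v) :=
          intervalIntegral.integral_mono_on h (hi _ _) intervalIntegrable_const fun s hs =>
            tanh_mono (mul_le_mul_of_nonneg_left hs.2 hβ)
      _ = Real.tanh (β * v) * (v - w) := by
          rw [intervalIntegral.integral_const, smul_eq_mul, mul_comm]
  · have h1 : ∫ _ in v..w, Real.tanh (β * v) ≤ ∫ s in v..w, Real.tanh (β * s) :=
      intervalIntegral.integral_mono_on h intervalIntegrable_const (hi _ _) fun s hs =>
        tanh_mono (mul_le_mul_of_nonneg_left hs.1 hβ)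
    rw [intervalIntegral.integral_const, smul_eq_mul] at h1
    rw [intervalIntegral.integral_symm]
    linarith

lemma tanhPrimitive_nonneg {β : ℝ} (hβ : 0 ≤ β) (v : ℝ) : 0 ≤ tanhPrimitive β v := by
  have := tanhPrimitive_sub_le hβ 0 v
  rw [tanhPrimitive_zero, mul_zero, Real.tanh_zero] at this
  linarith

lemma tanhPrimitive_le_abs {β : ℝ} (hβ : 0 ≤ β) (v : ℝ) : tanhPrimitive β v ≤ |v| := by
  have h := tanhPrimitive_sub_le hβ v 0
  rw [tanhPrimitive_zero, sub_zero, sub_zero] at h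
  refine h.trans ((le_abs_self _).trans ?_)
  rw [abs_mul]
  exact mul_le_of_le_one_left (abs_nonneg _) (abs_tanh_le_one _)

/-! ### Integrals of bounded functions -/

lemma intervalIntegrable_of_abs_le {f : ℝ → ℝ} (hf : Measurable f) {C : ℝ} (hC : ∀ t, |f t| ≤ C)
    (a b : ℝ) : IntervalIntegrable f volume a b :=
  (intervalIntegrable_const (c := C)).mono_fun' hf.aestronglyMeasurable
    (Filter.Eventually.of_forall hC)

lemma measurable_integral_mul_comp_sub {K g : ℝ → ℝ} (hK : Measurable K) (hg : Measurable g) :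
    Measurable fun t => ∫ τ, K τ * g (t - τ) := by
  refine (StronglyMeasurable.integral_prod_right (f := fun t τ => K τ * g (t - τ)) ?_).measurable
  exact (Measurable.mul (hK.comp measurable_snd)
    (hg.comp (measurable_fst.sub measurable_snd))).stronglyMeasurable

lemma integrable_mul_comp_sub {K g : ℝ → ℝ} (hK : Integrable K) (hg : Measurable g)
    (hg1 : ∀ t, |g t| ≤ 1) (t : ℝ) : Integrable fun τ => K τ * g (t - τ) := by
  refine hK.mul_bdd (c := 1) ?_ (Filter.Eventually.of_forall fun τ => hg1 _)
  exact (hg.comp (measurable_const.sub measurable_id)).aestronglyMeasurable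

lemma measurable_popovKernel (q h : ℝ) : Measurable (popovKernel q h) := by
  have h1 := measurable_kernelTail
  have h2 : Measurable fun t => kernelTail (t - h) := h1.comp (measurable_id.sub_const h)
  have h3 : Measurable ((Ioc 0 h).indicator (1 : ℝ → ℝ)) := measurable_one.indicator measurableSet_Ioc
  exact h1.neg.sub (((h1.sub h2).sub (h3.const_mul _)).const_mul _)

lemma popovKernel_of_nonpos {q h t : ℝ} (hh : 0 ≤ h) (ht : t ≤ 0) : popovKernel q h t = 0 := by
  rw [popovKernel, kernelTail_of_nonpos ht, kernelTail_of_nonpos (by linarith),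
    indicator_of_notMem fun hm => hm.1.not_ge ht]
  simp

lemma integral_popovKernel_mul {q h : ℝ} (hh : 0 ≤ h) {g : ℝ → ℝ} (hg : Measurable g)
    (hg1 : ∀ t, |g t| ≤ 1) (t : ℝ) :
    ∫ τ, popovKernel q h τ * g (t - τ) =
      -(∫ τ, kernelTail τ * g (t - τ)) - q / h * ((∫ τ, kernelTail τ * g (t - τ))
        - (∫ τ, kernelTail τ * g (t - h - τ))
        - 1 / Real.pi * ((∫ τ in (0 : ℝ)..t, g τ) - ∫ τ in (0 : ℝ)..(t - h), g τ)) := by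
  have i1 := integrable_mul_comp_sub integrable_kernelTail hg hg1 t
  have i2 := integrable_mul_comp_sub (integrable_kernelTail.comp_sub_right h) hg hg1 t
  have i3 := integrable_mul_comp_sub (integrable_indicator_Ioc_one h) hg hg1 t
  have hi := intervalIntegrable_of_abs_le hg hg1
  have e2 : ∫ τ, kernelTail (τ - h) * g (t - τ) = ∫ τ, kernelTail τ * g (t - h - τ) := by
    rw [← integral_add_right_eq_self _ h]
    refine integral_congr_ae (Filter.Eventually.of_forall fun τ => ?_)
    simp only [add_sub_cancel_right]
    rw [show t - (τ + h) = t - h - τ by ring]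
  have e3 : ∫ τ, (Ioc 0 h).indicator (1 : ℝ → ℝ) τ * g (t - τ) =
      (∫ τ in (0 : ℝ)..t, g τ) - ∫ τ in (0 : ℝ)..(t - h), g τ := by
    rw [intervalIntegral.integral_interval_sub_left (hi _ _) (hi _ _)]
    have : ∀ τ, (Ioc 0 h).indicator (1 : ℝ → ℝ) τ * g (t - τ) =
        (Ioc 0 h).indicator (fun τ => g (t - τ)) τ := fun τ => by
      by_cases hτ : τ ∈ Ioc 0 h
      · simp [indicator_of_mem hτ]
      · simp [indicator_of_notMem hτ]
    simp_rw [this]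
    rw [integral_indicator measurableSet_Ioc, ← intervalIntegral.integral_of_le hh,
      intervalIntegral.integral_comp_sub_left (fun τ => g τ), sub_zero]
  rw [← e2, ← e3, ← integral_sub i1 i2, ← integral_const_mul,
    ← integral_sub (by exact i1.sub i2) (by exact i3.const_mul _), ← integral_const_mul,
    ← integral_neg,
    ← integral_sub (by exact i1.neg) (by exact ((i1.sub i2).sub (i3.const_mul _)).const_mul _)]
  refine integral_congr_ae (Filter.Eventually.of_forall fun τ => ?_)
  simp only [popovKernel]
  ring

/-- Integration of a function against its primitive. -/
lemma integral_mul_primitive {g : ℝ → ℝ} (hg : Measurable g) (hg1 : ∀ t, |g t| ≤ 1)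
    (hgc : ContinuousOn g (Ioi 0)) {T : ℝ} (hT : 0 ≤ T) :
    ∫ t in (0 : ℝ)..T, g t * ∫ τ in (0 : ℝ)..t, g τ = (∫ τ in (0 : ℝ)..T, g τ) ^ 2 / 2 := by
  have hi := intervalIntegrable_of_abs_le hg hg1
  have hc := intervalIntegral.continuous_primitive hi 0
  have h := intervalIntegral.integral_eq_sub_of_hasDerivAt_of_le hT
    (f := fun t => (∫ τ in (0 : ℝ)..t, g τ) ^ 2 / 2)
    (f' := fun t => g t * ∫ τ in (0 : ℝ)..t, g τ) ((hc.pow 2).div_const 2).continuousOn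
    (fun x hx => ?_) ((hi 0 T).mul_continuousOn hc.continuousOn)
  · rw [h]; simp
  · have hd := intervalIntegral.integral_hasDerivAt_right (hi 0 x)
      hg.stronglyMeasurable.stronglyMeasurableAtFilter
      (hgc.continuousAt (Ioi_mem_nhds hx.1))
    convert! (hd.pow 2).div_const 2 using 1
    ring

/-- A nonnegative function vanishing on the left half line loses mass when translated to the
right. -/
lemma integral_sub_comp_sub_nonneg {p : ℝ → ℝ} (hp : ∀ a b, IntervalIntegrable p volume a b)
    (hp0 : ∀ t, 0 ≤ p t) (hpn : ∀ t ≤ 0, p t = 0) {h : ℝ} (hh : 0 ≤ h) (T : ℝ) :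
    0 ≤ (∫ t in (0 : ℝ)..T, p t) - ∫ t in (0 : ℝ)..T, p (t - h) := by
  rw [intervalIntegral.integral_comp_sub_right (fun t => p t),
    intervalIntegral.integral_interval_sub_interval_comm' (hp _ _) (hp _ _) (hp _ _)]
  have e : ∫ t in (0 - h)..0, p t = 0 := by
    refine intervalIntegral.integral_zero_ae (Filter.Eventually.of_forall fun t ht => hpn t ?_)
    rw [uIoc_of_le (by linarith)] at ht
    exact ht.2
  rw [e, sub_zero]
  exact intervalIntegral.integral_nonneg (by linarith) fun t _ => hp0 t

/-! ### The energy estimate -/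

lemma integral_indicator_Ioo_eq {f : ℝ → ℝ} {T : ℝ} (hT : 0 ≤ T) :
    ∫ t, (Ioo 0 T).indicator f t = ∫ t in (0 : ℝ)..T, f t := by
  rw [integral_indicator measurableSet_Ioo, intervalIntegral.integral_of_le hT,
    integral_Ioc_eq_integral_Ioo]

open FourierTransform in
/-- The quadratic form of a causal kernel on an interval. -/
lemma integral_mul_causal_nonneg {K g : ℝ → ℝ} (hK : Integrable K) (hK0 : ∀ t ≤ 0, K t = 0)
    (hg : ContinuousOn g (Ioi 0)) (hg1 : ∀ t, |g t| ≤ 1) (hg0 : ∀ t ≤ 0, g t = 0) {T c : ℝ}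
    (hT : 0 ≤ T) (hfreq : ∀ ξ : ℝ, ξ ≠ 0 → 0 ≤ (𝓕 (fun t => (K t : ℂ)) ξ).re + c) :
    0 ≤ (∫ t in (0 : ℝ)..T, g t * ∫ τ, K τ * g (t - τ)) + c * ∫ t in (0 : ℝ)..T, g t ^ 2 := by
  have h := quadForm_nonneg hK hg hg1 T hfreq
  -- For t in (0, T) the truncation of the inner g is invisible: causality excludes times after T,
  -- and g vanishes before 0.
  have e1 : ∀ t, (Ioo 0 T).indicator g t * ∫ τ, K τ * (Ioo 0 T).indicator g (t - τ) =
      (Ioo 0 T).indicator (fun t => g t * ∫ τ, K τ * g (t - τ)) t := fun t => by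
    by_cases ht : t ∈ Ioo 0 T
    · simp only [indicator_of_mem ht]
      congr 1
      refine integral_congr_ae (Filter.Eventually.of_forall fun τ => ?_)
      simp only
      rcases le_or_gt τ 0 with hτ | hτ
      · rw [hK0 τ hτ, zero_mul, zero_mul]
      · by_cases h2 : t - τ ∈ Ioo 0 T
        · rw [indicator_of_mem h2]
        · rw [indicator_of_notMem h2, hg0]
          by_contra! h3
          exact h2 ⟨h3, by linarith [ht.2]⟩
    · simp only [indicator_of_notMem ht, zero_mul]
  have e2 : ∀ t, (Ioo 0 T).indicator g t ^ 2 = (Ioo 0 T).indicator (fun t => g t ^ 2) t :=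
    fun t => by
      by_cases ht : t ∈ Ioo 0 T
      · simp only [indicator_of_mem ht]
      · simp only [indicator_of_notMem ht]; norm_num
  simp_rw [e1, e2] at h
  rwa [integral_indicator_Ioo_eq hT, integral_indicator_Ioo_eq hT] at h

/-- A Volterra equation with a forcing that converges exponentially: below the critical gain, the
feedback is square integrable along bounded solutions. -/
theorem exists_integral_sq_tanh_le {β : ℝ} (hβ : β ∈ Ioo 0 beta0) {y f : ℝ → ℝ}
    (hym : Measurable y) (hyc : ContinuousOn y (Ioi 0)) (hy0 : ∀ t ≤ 0, y t = 0) {C : ℝ}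
    (hC : ∀ t, |y t| ≤ C) {L D : ℝ} (hf : ∀ t, 0 < t → |f t - L| ≤ D * Real.exp (-t))
    (hE : ∀ t, y t = f t + ((∫ τ, kernelTail τ * Real.tanh (β * y (t - τ)))
      - 1 / Real.pi * ∫ τ in (0 : ℝ)..t, Real.tanh (β * y τ))) :
    ∃ Q : ℝ, ∀ T : ℝ, 0 ≤ T → ∫ t in (0 : ℝ)..T, Real.tanh (β * y t) ^ 2 ≤ Q := by
  obtain ⟨hβ0, hββ⟩ := hβ
  have hπ := Real.pi_pos
  set g : ℝ → ℝ := fun t => Real.tanh (β * y t) with hg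
  have hgm : Measurable g := continuous_tanh.measurable.comp (hym.const_mul β)
  have hgc : ContinuousOn g (Ioi 0) := continuous_tanh.comp_continuousOn (hyc.const_smul β)
  have hg1 : ∀ t, |g t| ≤ 1 := fun t => abs_tanh_le_one _
  have hg0 : ∀ t ≤ 0, g t = 0 := fun t ht => by simp only [hg, hy0 t ht, mul_zero, Real.tanh_zero]
  have hgi := intervalIntegrable_of_abs_le hgm hg1
  have hGc := intervalIntegral.continuous_primitive hgi 0
  obtain ⟨q, hq, hfreq⟩ := exists_popovKernel_frequency
  have hδ : 0 < 1 / β - 1 / beta0 := sub_pos.mpr (one_div_lt_one_div_of_lt hβ0 hββ)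
  set δ := 1 / β - 1 / beta0 with hδ'
  -- The step is so small that the discretisation loss 2qh uses at most half of the gap δ between
  -- 1/β and 1/β₀.
  set h := δ / (4 * (q + 1)) with hh'
  have hh : 0 < h := by positivity
  have hqh : 2 * q * h ≤ δ / 2 := by
    have : h * (4 * (q + 1)) = δ := div_mul_cancel₀ _ (by positivity)
    nlinarith
  set W : ℝ → ℝ := fun t => ∫ τ, popovKernel q h τ * g (t - τ) with hW
  have hWm : Measurable W := measurable_integral_mul_comp_sub (measurable_popovKernel q h) hgm
  have hWb : ∀ t, |W t| ≤ 1 * ∫ τ, |popovKernel q h τ| := fun t =>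
    abs_integral_mul_comp_sub_le (integrable_popovKernel q h) hg1 t
  set F : ℝ → ℝ := fun t => f t + q / h * (f t - f (t - h)) with hF
  have hId : ∀ t, F t = y t + q / h * (y t - y (t - h))
      + 1 / Real.pi * (∫ τ in (0 : ℝ)..t, g τ) + W t := fun t => by
    have h1 := hE t
    have h2 := hE (t - h)
    simp only [hF, hW]
    rw [integral_popovKernel_mul hh.le hgm hg1]
    simp only [hg] at *
    rw [h1, h2]
    ring
  -- The translate f(t - h) sees negative times, where the equation itself forces f to vanish.
  have hfn : ∀ t ≤ 0, f t = 0 := fun t ht => by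
    have h1 := hE t
    have z1 : ∫ τ, kernelTail τ * g (t - τ) = 0 := by
      refine integral_eq_zero_of_ae (Filter.Eventually.of_forall fun τ => ?_)
      rcases le_or_gt τ 0 with hτ | hτ
      · simp [kernelTail_of_nonpos hτ]
      · simp [hg0 (t - τ) (by linarith)]
    have z2 : ∫ τ in (0 : ℝ)..t, g τ = 0 := by
      refine intervalIntegral.integral_zero_ae (Filter.Eventually.of_forall fun τ hτ => hg0 τ ?_)
      rw [uIoc_of_ge ht] at hτ
      exact hτ.2
    rw [hy0 t ht, z1, z2] at h1
    linarith
  have hD : 0 ≤ D := by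
    have := (abs_nonneg _).trans (hf 1 one_pos)
    exact nonneg_of_mul_nonneg_left this (Real.exp_pos _)
  -- The summand with |L| covers 0 < t ≤ h, where f(t - h) = 0 is not near L but eʰe⁻ᵗ ≥ 1.
  set D' := D + q / h * (D + (D + |L|) * Real.exp h) with hD'
  have hFL : ∀ t, 0 < t → |F t - L| ≤ D' * Real.exp (-t) := fun t ht => by
    have hlag : |f t - f (t - h)| ≤ (D + (D + |L|) * Real.exp h) * Real.exp (-t) := by
      have a1 := hf t ht
      rcases lt_or_ge h t with hlt | hge
      · have a2 := hf (t - h) (by linarith)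
        rw [show -(t - h) = h + -t by ring, Real.exp_add] at a2
        have a3 : 0 ≤ |L| * (Real.exp h * Real.exp (-t)) := by positivity
        calc |f t - f (t - h)| = |(f t - L) - (f (t - h) - L)| := by ring_nf
          _ ≤ |f t - L| + |f (t - h) - L| := abs_sub _ _
          _ ≤ _ := by linarith
      · rw [hfn (t - h) (by linarith), sub_zero]
        have a2 : 1 ≤ Real.exp h * Real.exp (-t) := by
          rw [← Real.exp_add]; exact Real.one_le_exp (by linarith)
        have a3 : |f t| ≤ |f t - L| + |L| := by
          calc |f t| = |(f t - L) + L| := by ring_nf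
            _ ≤ _ := abs_add_le _ _
        have a4 := mul_le_mul_of_nonneg_left a2 (abs_nonneg L)
        have a5 : 0 ≤ D * (Real.exp h * Real.exp (-t)) := by positivity
        linarith
    calc |F t - L| = |(f t - L) + q / h * (f t - f (t - h))| := by
          simp only [hF]; ring_nf
      _ ≤ |f t - L| + |q / h * (f t - f (t - h))| := abs_add_le _ _
      _ = |f t - L| + q / h * |f t - f (t - h)| := by
          rw [abs_mul, abs_of_nonneg (by positivity : 0 ≤ q / h)]
      _ ≤ D * Real.exp (-t) + q / h * ((D + (D + |L|) * Real.exp h) * Real.exp (-t)) := by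
          gcongr
          exact hf t ht
      _ = D' * Real.exp (-t) := by rw [hD']; ring
  have hD'0 : 0 ≤ D' := by positivity
  set p : ℝ → ℝ := fun t => tanhPrimitive β (y t) with hp
  have hpm : Measurable p := (continuous_tanhPrimitive β).measurable.comp hym
  have hp0 : ∀ t, 0 ≤ p t := fun t => tanhPrimitive_nonneg hβ0.le _
  have hpC : ∀ t, |p t| ≤ C := fun t => by
    rw [abs_of_nonneg (hp0 t)]
    exact (tanhPrimitive_le_abs hβ0.le _).trans (hC t)
  have hpn : ∀ t ≤ 0, p t = 0 := fun t ht => by simp only [hp, hy0 t ht, tanhPrimitive_zero]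
  have hpi := intervalIntegrable_of_abs_le hpm hpC
  have hpi' : ∀ a b, IntervalIntegrable (fun t => p (t - h)) volume a b :=
    intervalIntegrable_of_abs_le (hpm.comp (measurable_id.sub_const h)) fun t => hpC _
  -- The pointwise energy inequality: the transformed equation times g, with the sector condition
  -- and convexity inserted.
  have hpt : ∀ t, 0 < t → 1 / β * g t ^ 2 + q / h * (p t - p (t - h))
      + 1 / Real.pi * (g t * ∫ τ in (0 : ℝ)..t, g τ) + g t * W t
      ≤ L * g t + D' * Real.exp (-t) := fun t ht => by
    have b1 : 1 / β * g t ^ 2 ≤ g t * y t := by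
      have := sq_tanh_le (β * y t)
      rw [div_mul_eq_mul_div, one_mul, div_le_iff₀ hβ0]
      simp only [hg]
      linarith
    have b2 : q / h * (p t - p (t - h)) ≤ q / h * (g t * (y t - y (t - h))) :=
      mul_le_mul_of_nonneg_left (tanhPrimitive_sub_le hβ0.le _ _) (by positivity)
    have b3 : g t * (F t - L) ≤ D' * Real.exp (-t) := by
      refine (le_abs_self _).trans ?_
      rw [abs_mul]
      exact (mul_le_of_le_one_left (abs_nonneg _) (hg1 t)).trans (hFL t ht)
    have b4 := hId t
    rw [b4] at b3
    linarith
  refine ⟨(D' + Real.pi * L ^ 2 / 2) / (δ / 2), fun T hT => ?_⟩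
  have hexp : ∫ t in (0 : ℝ)..T, Real.exp (-t) ≤ 1 := by
    rw [intervalIntegral.integral_comp_neg Real.exp, integral_exp, neg_zero, Real.exp_zero]
    linarith [Real.exp_pos (-T)]
  have hsq : IntervalIntegrable (fun t => g t ^ 2) volume 0 T :=
    intervalIntegrable_of_abs_le (hgm.pow_const 2) (C := 1) (fun t => by
      rw [abs_pow]; exact pow_le_one₀ (abs_nonneg _) (hg1 t)) _ _
  have hgW : IntervalIntegrable (fun t => g t * W t) volume 0 T :=
    intervalIntegrable_of_abs_le (hgm.mul hWm) (fun t => by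
      rw [Pi.mul_apply, abs_mul]
      exact (mul_le_of_le_one_left (abs_nonneg _) (hg1 t)).trans (hWb t)) _ _
  have hgG : IntervalIntegrable (fun t => g t * ∫ τ in (0 : ℝ)..t, g τ) volume 0 T :=
    (hgi 0 T).mul_continuousOn hGc.continuousOn
  have hex : IntervalIntegrable (fun t => Real.exp (-t)) volume 0 T :=
    (by fun_prop : Continuous fun t : ℝ => Real.exp (-t)).intervalIntegrable _ _
  have hI1 := hsq.const_mul (1 / β)
  have hI2 := ((hpi 0 T).sub (hpi' 0 T)).const_mul (q / h)
  have hI3 := hgG.const_mul (1 / Real.pi)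
  have hmono := intervalIntegral.integral_mono_on_of_le_Ioo hT
    (((hI1.add hI2).add hI3).add hgW) (((hgi 0 T).const_mul L).add (hex.const_mul D'))
    fun t ht => hpt t ht.1
  rw [intervalIntegral.integral_add ((hI1.add hI2).add hI3) hgW,
    intervalIntegral.integral_add (hI1.add hI2) hI3, intervalIntegral.integral_add hI1 hI2,
    intervalIntegral.integral_const_mul, intervalIntegral.integral_const_mul,
    intervalIntegral.integral_const_mul, intervalIntegral.integral_sub (hpi 0 T) (hpi' 0 T),
    intervalIntegral.integral_add ((hgi 0 T).const_mul L) (hex.const_mul D'),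
    intervalIntegral.integral_const_mul, intervalIntegral.integral_const_mul,
    integral_mul_primitive hgm hg1 hgc hT] at hmono
  have hquad := integral_mul_causal_nonneg (integrable_popovKernel q h)
    (fun t ht => popovKernel_of_nonpos hh.le ht) hgc hg1 hg0 hT (hfreq h hh)
  have htrans := mul_nonneg (by positivity : 0 ≤ q / h)
    (integral_sub_comp_sub_nonneg hpi hp0 hpn hh.le T)
  have hQ0 : 0 ≤ ∫ t in (0 : ℝ)..T, g t ^ 2 :=
    intervalIntegral.integral_nonneg hT fun t _ => sq_nonneg _
  have hexp' := mul_le_mul_of_nonneg_left hexp hD'0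
  change 0 ≤ (∫ t in (0 : ℝ)..T, g t * W t) + _ at hquad
  change ∫ t in (0 : ℝ)..T, g t ^ 2 ≤ _
  generalize (∫ t in (0 : ℝ)..T, g t ^ 2) = Q at *
  generalize (∫ τ in (0 : ℝ)..T, g τ) = G at *
  -- Completing the square absorbs the contribution LG of the limiting forcing, although G is not
  -- yet known to be bounded.
  have hsqr : L * G - 1 / Real.pi * (G ^ 2 / 2) ≤ Real.pi * L ^ 2 / 2 := by
    have : Real.pi * L ^ 2 / 2 - (L * G - 1 / Real.pi * (G ^ 2 / 2)) =
        (Real.pi * L - G) ^ 2 / (2 * Real.pi) := by field_simp; ring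
    have h2 : 0 ≤ (Real.pi * L - G) ^ 2 / (2 * Real.pi) := by positivity
    linarith
  have hβδ : 1 / β = δ + 1 / beta0 := by rw [hδ']; ring
  have hcQ := mul_le_mul_of_nonneg_right hqh hQ0
  rw [hβδ] at hmono
  rw [le_div_iff₀ (by positivity)]
  linarith

/-! ### The forcing term -/

lemma abs_eigenfun_le_one (k : ℕ) (x : ℝ) : |eigenfun k x| ≤ 1 := by
  have hπ := Real.pi_gt_three
  unfold eigenfun
  split_ifs
  · rw [abs_of_nonneg (by positivity), div_le_one (by positivity)]
    exact Real.one_le_sqrt.mpr (by linarith)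
  · rw [abs_mul, abs_of_nonneg (Real.sqrt_nonneg _)]
    refine mul_le_one₀ (Real.sqrt_le_one.mpr ?_) (abs_nonneg _) (Real.abs_cos_le_one _)
    rw [div_le_one (by positivity)]
    linarith

lemma MemH1.integrableOn {u : ℝ → ℝ} (hu : MemH1 u) : IntegrableOn u (Ioo 0 Real.pi) := by
  have : IsFiniteMeasure (volume.restrict (Ioo 0 Real.pi)) :=
    ⟨by rw [Measure.restrict_apply_univ]; exact measure_Ioo_lt_top⟩
  exact hu.1.integrable one_le_two

lemma abs_pairing_eigenfun_le {u : ℝ → ℝ} (hu : IntegrableOn u (Ioo 0 Real.pi)) (k : ℕ) :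
    |pairing u (eigenfun k)| ≤ ∫ x in Ioo 0 Real.pi, |u x| := by
  rw [pairing, ← Real.norm_eq_abs]
  refine norm_integral_le_of_norm_le hu.abs (Filter.Eventually.of_forall fun x => ?_)
  rw [Real.norm_eq_abs, abs_mul]
  exact mul_le_of_le_one_right (abs_nonneg _) (abs_eigenfun_le_one k x)

/-- The forcing term converges exponentially. -/
lemma exists_abs_forcing_sub_le {u : ℝ → ℝ} (hu : IntegrableOn u (Ioo 0 Real.pi)) :
    ∃ L D : ℝ, ∀ t : ℝ, 1 ≤ t → |forcing u t - L| ≤ D * Real.exp (-t) := by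
  set M := ∫ x in Ioo 0 Real.pi, |u x| with hM
  have hM0 : 0 ≤ M := integral_nonneg fun x => abs_nonneg _
  have hS : Summable fun k : ℕ => Real.exp (-1 * ((k + 1 : ℕ) : ℝ) ^ 2) :=
    (summable_nat_add_iff 1).mpr (summable_exp_sq one_pos)
  refine ⟨pairing u (eigenfun 0) * eigenfun 0 Real.pi,
    M * Real.exp 1 * ∑' k : ℕ, Real.exp (-1 * ((k + 1 : ℕ) : ℝ) ^ 2), fun t ht => ?_⟩
  have hterm : ∀ k : ℕ,
      ‖Real.exp (-t * (k : ℝ) ^ 2) * pairing u (eigenfun k) * eigenfun k Real.pi‖ ≤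
        M * Real.exp (-t * (k : ℝ) ^ 2) := fun k => by
    rw [Real.norm_eq_abs, abs_mul, abs_mul, Real.abs_exp]
    calc _ ≤ Real.exp (-t * (k : ℝ) ^ 2) * M * 1 := by
          gcongr
          · exact abs_pairing_eigenfun_le hu k
          · exact abs_eigenfun_le_one _ _
      _ = _ := by ring
  have hs : Summable fun k : ℕ =>
      Real.exp (-t * (k : ℝ) ^ 2) * pairing u (eigenfun k) * eigenfun k Real.pi :=
    Summable.of_norm_bounded ((summable_exp_sq (by linarith)).mul_left M) hterm
  have e : forcing u t - pairing u (eigenfun 0) * eigenfun 0 Real.pi =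
      ∑' k : ℕ, Real.exp (-t * ((k + 1 : ℕ) : ℝ) ^ 2) * pairing u (eigenfun (k + 1)) *
        eigenfun (k + 1) Real.pi := by
    rw [forcing, heatSemigroup, hs.tsum_eq_zero_add]
    simp
  rw [e, ← Real.norm_eq_abs]
  refine tsum_of_norm_bounded ((hS.hasSum.mul_left (M * Real.exp 1)).mul_right (Real.exp (-t)))
    fun k => (hterm (k + 1)).trans ?_
  -- With m = k + 1, the inequality (t - 1)(m² - 1) ≥ 0 gives tm² ≥ t + m² - 1, which separates the
  -- decay in t from the summation.
  have : Real.exp (-t * ((k + 1 : ℕ) : ℝ) ^ 2) ≤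
      Real.exp 1 * Real.exp (-1 * ((k + 1 : ℕ) : ℝ) ^ 2) * Real.exp (-t) := by
    rw [← Real.exp_add, ← Real.exp_add]
    apply Real.exp_le_exp.mpr
    have h1 : (1 : ℝ) ≤ ((k + 1 : ℕ) : ℝ) := by exact_mod_cast Nat.le_add_left 1 k
    nlinarith [mul_nonneg (sub_nonneg.mpr ht) (by nlinarith : (0 : ℝ) ≤ ((k + 1 : ℕ) : ℝ) ^ 2 - 1)]
  calc _ ≤ M * (Real.exp 1 * Real.exp (-1 * ((k + 1 : ℕ) : ℝ) ^ 2) * Real.exp (-t)) := by gcongr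
    _ = _ := by ring

/-! ### Asymptotics -/

lemma abs_kernelTail_le_one (t : ℝ) : |kernelTail t| ≤ 1 := by
  refine (abs_kernelTail_le t).trans ?_
  by_cases ht : t ∈ Ioi (0 : ℝ)
  · rw [indicator_of_mem ht]
    exact Real.exp_le_one_iff.mpr (by simpa using (mem_Ioi.mp ht).le)
  · rw [indicator_of_notMem ht]; exact zero_le_one

lemma tendsto_kernelTail : Filter.Tendsto kernelTail Filter.atTop (nhds 0) := by
  refine squeeze_zero_norm (fun t => ?_) Real.tendsto_exp_neg_atTop_nhds_zero
  exact (abs_kernelTail_le t).trans (indicator_le_self' (fun _ _ => (Real.exp_pos _).le) t)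

/-- Convolution with the decaying part of the kernel maps square integrable functions to
functions vanishing at infinity. -/
lemma tendsto_integral_kernelTail_mul {g : ℝ → ℝ} (hg : Measurable g)
    (hg2 : Integrable fun t => g t ^ 2) :
    Filter.Tendsto (fun t => ∫ τ, kernelTail τ * g (t - τ)) Filter.atTop (nhds 0) := by
  have hm : ∀ t, Measurable fun s => kernelTail (t - s) := fun t =>
    measurable_kernelTail.comp (measurable_const.sub measurable_id)
  have hS : Filter.Tendsto (fun t => ∫ s, |kernelTail (t - s)| * g s ^ 2) Filter.atTop (nhds 0) := by
    rw [← integral_zero ℝ ℝ (μ := volume)]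
    refine tendsto_integral_filter_of_dominated_convergence (fun s => g s ^ 2)
      (Filter.Eventually.of_forall fun t =>
        ((continuous_abs.measurable.comp (hm t)).mul (hg.pow_const 2)).aestronglyMeasurable)
      (Filter.Eventually.of_forall fun t => Filter.Eventually.of_forall fun s => ?_) hg2
      (Filter.Eventually.of_forall fun s => ?_)
    · rw [Real.norm_eq_abs, abs_mul, abs_abs, abs_of_nonneg (sq_nonneg (g s))]
      exact mul_le_of_le_one_left (sq_nonneg _) (abs_kernelTail_le_one _)
    · have h1 := (tendsto_kernelTail.comp
        (Filter.tendsto_atTop_add_const_right _ (-s) Filter.tendsto_id)).abs.mul_const (g s ^ 2)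
      simpa [sub_eq_add_neg] using h1
  set B := ∫ τ, |kernelTail τ| with hB
  have hB0 : 0 ≤ B := integral_nonneg fun _ => abs_nonneg _
  -- Uses |g| ≤ η + g²/η: the first part is small uniformly in t, the second tends to zero by `hS`
  -- for fixed η.
  have hV : ∀ η : ℝ, 0 < η → ∀ t, |∫ τ, kernelTail τ * g (t - τ)| ≤
      η * B + (∫ s, |kernelTail (t - s)| * g s ^ 2) / η := fun η hη t => by
    have hi : Integrable fun s => kernelTail (t - s) := integrable_kernelTail.comp_sub_left t
    have hi2 : Integrable fun s => |kernelTail (t - s)| * g s ^ 2 :=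
      hg2.bdd_mul (c := 1) (continuous_abs.measurable.comp (hm t)).aestronglyMeasurable
        (Filter.Eventually.of_forall fun s => by
          rw [Real.norm_eq_abs, abs_abs]; exact abs_kernelTail_le_one _)
    have e1 : ∫ τ, kernelTail τ * g (t - τ) = ∫ s, kernelTail (t - s) * g s := by
      rw [← integral_sub_left_eq_self _ volume t]
      simp
    have e2 : B = ∫ s, |kernelTail (t - s)| := by
      rw [hB, ← integral_sub_left_eq_self _ volume t]
    rw [e1, e2, ← integral_const_mul, ← integral_div, ← integral_add (hi.abs.const_mul η)
      (hi2.div_const η), ← Real.norm_eq_abs]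
    refine norm_integral_le_of_norm_le ((hi.abs.const_mul η).add (hi2.div_const η))
      (Filter.Eventually.of_forall fun s => ?_)
    have h1 : |g s| ≤ η + g s ^ 2 / η := by
      rw [← sq_abs, ← sub_nonneg]
      have : η + |g s| ^ 2 / η - |g s| = ((|g s| - η / 2) ^ 2 + 3 / 4 * η ^ 2) / η := by
        field_simp; ring
      rw [this]; positivity
    rw [Real.norm_eq_abs, abs_mul]
    calc |kernelTail (t - s)| * |g s| ≤ |kernelTail (t - s)| * (η + g s ^ 2 / η) := by gcongr
      _ = _ := by ring
  rw [Metric.tendsto_atTop']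
  intro ε hε
  set η := ε / (2 * (B + 1)) with hη'
  have hη : 0 < η := by positivity
  have hηB : η * B < ε / 2 := by
    have h1 : η * (2 * (B + 1)) = ε := div_mul_cancel₀ _ (by positivity)
    nlinarith
  obtain ⟨N, hN⟩ := Filter.eventually_atTop.mp (hS.eventually_lt_const
    (show (0 : ℝ) < η * (ε / 2) by positivity))
  refine ⟨N, fun t ht => ?_⟩
  rw [Real.dist_eq, sub_zero]
  have h2 := hN t ht.le
  have h3 : (∫ s, |kernelTail (t - s)| * g s ^ 2) / η < ε / 2 := by
    rw [div_lt_iff₀ hη]; linarith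
  linarith [hV η hη t]

/-- If `tanh (β y)` is square integrable and `y` is asymptotic to a Lipschitz function, then `y`
tends to zero. -/
lemma tendsto_zero_of_integrable_sq_tanh {β : ℝ} (hβ : 0 < β) {y Y : ℝ → ℝ} (hym : Measurable y)
    (hint : IntegrableOn (fun t => Real.tanh (β * y t) ^ 2) (Ioi 0))
    (hY : ∀ s t, |Y s - Y t| ≤ |s - t|)
    (hyY : Filter.Tendsto (fun t => y t - Y t) Filter.atTop (nhds 0)) :
    Filter.Tendsto y Filter.atTop (nhds 0) := by
  suffices hYlim : Filter.Tendsto Y Filter.atTop (nhds 0) by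
    simpa using hyY.add hYlim
  rw [Metric.tendsto_atTop']
  intro ε hε
  set m := Real.tanh (β * (ε / 4)) ^ 2 with hm
  have htp : 0 < Real.tanh (β * (ε / 4)) := by
    rw [Real.tanh_eq_sinh_div_cosh]
    exact div_pos (Real.sinh_pos_iff.mpr (by positivity)) (Real.cosh_pos _)
  have hm0 : 0 < m := by positivity
  have hmeas : Measurable fun t => Real.tanh (β * y t) ^ 2 :=
    (continuous_tanh.measurable.comp (hym.const_mul β)).pow_const 2
  have hi : ∀ a b, IntervalIntegrable (fun t => Real.tanh (β * y t) ^ 2) volume a b :=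
    intervalIntegrable_of_abs_le hmeas (C := 1) fun t => by
      rw [abs_pow]; exact pow_le_one₀ (abs_nonneg _) (abs_tanh_le_one _)
  have h1 := intervalIntegral_tendsto_integral_Ioi 0 hint Filter.tendsto_id
  have h2 := intervalIntegral_tendsto_integral_Ioi 0 hint
    (Filter.tendsto_atTop_add_const_right _ (ε / 2) Filter.tendsto_id)
  have h3 := h2.sub h1
  rw [sub_self] at h3
  obtain ⟨N₁, hN₁⟩ := Filter.eventually_atTop.mp (h3.eventually_lt_const
    (show (0 : ℝ) < ε / 2 * m by positivity))
  obtain ⟨N₂, hN₂⟩ := Metric.tendsto_atTop'.mp hyY (ε / 4) (by positivity)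
  refine ⟨max N₁ N₂, fun t ht => ?_⟩
  rw [Real.dist_eq, sub_zero]
  by_contra! hge
  have h4 := hN₁ t ((le_max_left _ _).trans ht.le)
  simp only [id] at h4
  rw [intervalIntegral.integral_interval_sub_left (hi _ _) (hi _ _)] at h4
  -- If |Y(t)| ≥ ε, the Lipschitz bound keeps |Y| ≥ ε/2, hence |y| ≥ ε/4, on an interval of length
  -- ε/2. Its mass εm/2 contradicts the smallness of the tail.
  have h5 : ∫ _ in t..(t + ε / 2), m ≤ ∫ s in t..(t + ε / 2), Real.tanh (β * y s) ^ 2 := by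
    refine intervalIntegral.integral_mono_on (by linarith) intervalIntegrable_const (hi _ _)
      fun s hs => ?_
    have a1 := hY s t
    rw [abs_of_nonneg (by linarith [hs.1] : 0 ≤ s - t)] at a1
    have a2 := hN₂ s (lt_of_lt_of_le (lt_of_le_of_lt (le_max_right _ _) ht) hs.1)
    rw [Real.dist_eq, sub_zero] at a2
    have a3 : ε / 4 ≤ |y s| := by
      have b1 : |Y t| ≤ |Y s - Y t| + |y s - Y s| + |y s| := by
        calc |Y t| = |-(Y s - Y t) + -(y s - Y s) + y s| := by ring_nf
          _ ≤ |-(Y s - Y t)| + |-(y s - Y s)| + |y s| := abs_add_three _ _ _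
          _ = _ := by rw [abs_neg, abs_neg]
      linarith [hs.2]
    have a4 : Real.tanh (β * |y s|) ^ 2 = Real.tanh (β * y s) ^ 2 := by
      rcases abs_choice (y s) with h | h
      · rw [h]
      · rw [h, mul_neg, Real.tanh_neg, neg_sq]
    rw [← a4, hm]
    exact pow_le_pow_left₀ htp.le (tanh_mono (by gcongr)) 2
  rw [intervalIntegral.integral_const, smul_eq_mul, add_sub_cancel_left] at h5
  linarith

/-- The Volterra operator on the half line, in terms of the decaying part of the kernel. -/
lemma integral_kernel_mul_eq {g : ℝ → ℝ} (hg : Measurable g) (hg1 : ∀ t, |g t| ≤ 1)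
    (hg0 : ∀ t ≤ 0, g t = 0) {t : ℝ} (ht : 0 < t) :
    ∫ τ in (0 : ℝ)..t, kernel (t - τ) * g τ =
      (∫ τ, kernelTail τ * g (t - τ)) - 1 / Real.pi * ∫ τ in (0 : ℝ)..t, g τ := by
  have hi : Integrable fun s => kernelTail (t - s) * g s :=
    (integrable_kernelTail.comp_sub_left t).mul_bdd (c := 1) hg.aestronglyMeasurable
      (Filter.Eventually.of_forall hg1)
  have e1 : ∫ τ, kernelTail τ * g (t - τ) = ∫ s in (0 : ℝ)..t, kernelTail (t - s) * g s := by
    rw [← integral_sub_left_eq_self _ volume t, intervalIntegral.integral_of_le ht.le,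
      setIntegral_eq_integral_of_forall_compl_eq_zero]
    · simp
    · intro s hs
      rcases le_or_gt s 0 with h | h
      · rw [hg0 s h, mul_zero]
      · rw [kernelTail_of_nonpos, zero_mul]
        by_contra! h2
        exact hs ⟨h, by linarith⟩
  rw [e1, ← intervalIntegral.integral_const_mul, ← intervalIntegral.integral_sub
    hi.intervalIntegrable ((intervalIntegrable_of_abs_le hg hg1 0 t).const_mul _),
    intervalIntegral.integral_of_le ht.le, intervalIntegral.integral_of_le ht.le,
    integral_Ioc_eq_integral_Ioo, integral_Ioc_eq_integral_Ioo]
  -- The open interval omits s = t, where `kernelTail 0` is 0 by convention and need not equal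
  -- `kernel 0 + 1 / π`.
  refine setIntegral_congr_fun measurableSet_Ioo fun s hs => ?_
  rw [kernelTail_of_pos (sub_pos.mpr hs.2)]
  ring

end Thermostat

/-! ### Convergence of bounded solutions below the Hopf value -/

theorem mainTheorem2 (β : ℝ) (hβ : β ∈ Set.Ioo 0 Thermostat.beta0)
    (u₀ : ℝ → ℝ) (hu₀ : Thermostat.MemH1 u₀)
    (y : ℝ → ℝ) (hcont : ContinuousOn y (Set.Ioi 0))
    (hbdd : ∃ C : ℝ, ∀ t : ℝ, 0 < t → |y t| ≤ C)
    (hy : Thermostat.SolvesVolterra β u₀ y) :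
    Filter.Tendsto y Filter.atTop (nhds 0) := by
  open Thermostat MeasureTheory Set in
  have hπ := Real.pi_gt_three
  obtain ⟨C, hC⟩ := hbdd
  have hC0 : 0 ≤ C := (abs_nonneg _).trans (hC 1 one_pos)
  -- Values of y at nonpositive times are arbitrary; extension by zero makes the Volterra integral a
  -- causal convolution on the whole line.
  set z : ℝ → ℝ := (Ioi (0 : ℝ)).indicator y with hz
  have hzy : ∀ t, 0 < t → z t = y t := fun t ht => indicator_of_mem (mem_Ioi.mpr ht) y
  have hz0 : ∀ t ≤ 0, z t = 0 := fun t ht => indicator_of_notMem (by simpa using ht) y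
  have hzC : ∀ t, |z t| ≤ C := fun t => by
    rcases le_or_gt t 0 with h | h
    · rw [hz0 t h, abs_zero]; exact hC0
    · rw [hzy t h]; exact hC t h
  have hzc : ContinuousOn z (Ioi 0) := hcont.congr fun t ht => hzy t ht
  have hzm : Measurable z := by
    classical
    rw [hz, ← piecewise_eq_indicator]
    exact hcont.measurable_piecewise continuousOn_const measurableSet_Ioi
  set g : ℝ → ℝ := fun t => Real.tanh (β * z t) with hg
  have hgm : Measurable g := continuous_tanh.measurable.comp (hzm.const_mul β)
  have hg1 : ∀ t, |g t| ≤ 1 := fun t => abs_tanh_le_one _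
  have hg0 : ∀ t ≤ 0, g t = 0 := fun t ht => by simp only [hg, hz0 t ht, mul_zero, Real.tanh_zero]
  have hgi := intervalIntegrable_of_abs_le hgm hg1
  set V : ℝ → ℝ := fun t => ∫ τ, kernelTail τ * g (t - τ) with hV
  set G : ℝ → ℝ := fun t => ∫ τ in (0 : ℝ)..t, g τ with hG
  have hVb : ∀ t, |V t| ≤ 1 * ∫ τ, |kernelTail τ| := fun t =>
    abs_integral_mul_comp_sub_le integrable_kernelTail hg1 t
  have hGlip : ∀ s t, |G s - G t| ≤ |s - t| := fun s t => by
    simp only [hG]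
    rw [intervalIntegral.integral_interval_sub_left (hgi _ _) (hgi _ _)]
    have := intervalIntegral.norm_integral_le_of_norm_le_const (f := g) (a := t) (b := s) (C := 1)
      fun x _ => hg1 x
    rwa [one_mul] at this
  -- Defined as the residual, f satisfies the equation at every real t and equals the forcing for t
  -- > 0.
  set f : ℝ → ℝ := fun t => z t - (V t - 1 / Real.pi * G t) with hf
  have hff : ∀ t, 0 < t → f t = forcing u₀ t := fun t ht => by
    have h1 := hy t ht
    have h2 : ∫ τ in (0 : ℝ)..t, kernel (t - τ) * Real.tanh (β * y τ) =
        ∫ τ in (0 : ℝ)..t, kernel (t - τ) * g τ := by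
      rw [intervalIntegral.integral_of_le ht.le, intervalIntegral.integral_of_le ht.le]
      refine setIntegral_congr_fun measurableSet_Ioc fun s hs => ?_
      simp only [hg, hzy s hs.1]
    rw [h2, integral_kernel_mul_eq hgm hg1 hg0 ht] at h1
    simp only [hf, hzy t ht, hV, hG]
    linarith
  obtain ⟨L, D, hD⟩ := exists_abs_forcing_sub_le hu₀.integrableOn
  -- For t < 1 the spectral series is not estimated: f is bounded there because z, V and G are, and
  -- e · e⁻ᵗ ≥ 1.
  obtain ⟨D', hD'⟩ : ∃ D' : ℝ, ∀ t, 0 < t → |f t - L| ≤ D' * Real.exp (-t) := by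
    set M := C + (1 * ∫ τ, |kernelTail τ|) + 1 + |L| with hM
    have hK : 0 ≤ 1 * ∫ τ, |kernelTail τ| := (abs_nonneg _).trans (hVb 0)
    have hM0 : 0 ≤ M := by positivity
    refine ⟨max D (M * Real.exp 1), fun t ht => ?_⟩
    rcases le_or_gt 1 t with h | h
    · rw [hff t ht]
      exact (hD t h).trans (mul_le_mul_of_nonneg_right (le_max_left _ _) (Real.exp_pos _).le)
    · have h1 : |1 / Real.pi * G t| ≤ 1 := by
        have h2 := hGlip t 0
        have h3 : G 0 = 0 := intervalIntegral.integral_same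
        rw [h3, sub_zero, sub_zero, abs_of_pos ht] at h2
        rw [abs_mul, abs_of_nonneg (by positivity : 0 ≤ 1 / Real.pi)]
        exact mul_le_one₀ ((div_le_one (by linarith)).mpr (by linarith)) (abs_nonneg _)
          (h2.trans h.le)
      have h2 : |f t - L| ≤ M := by
        calc |f t - L| = |z t + -V t + 1 / Real.pi * G t + -L| := by simp only [hf]; ring_nf
          _ ≤ |z t| + |-V t| + |1 / Real.pi * G t| + |-L| := by
            refine (abs_add_le _ _).trans (add_le_add_left ((abs_add_three _ _ _)) _)
          _ ≤ M := by
            rw [abs_neg, abs_neg, hM]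
            linarith [hzC t, hVb t]
      refine h2.trans ?_
      have h3 : 1 ≤ Real.exp 1 * Real.exp (-t) := by
        rw [← Real.exp_add]; exact Real.one_le_exp (by linarith)
      calc M ≤ M * (Real.exp 1 * Real.exp (-t)) := le_mul_of_one_le_right hM0 h3
        _ = M * Real.exp 1 * Real.exp (-t) := by ring
        _ ≤ _ := mul_le_mul_of_nonneg_right (le_max_right _ _) (Real.exp_pos _).le
  obtain ⟨Q, hQ⟩ := exists_integral_sq_tanh_le hβ hzm hzc hz0 hzC hD'
    fun t => by simp only [hf, hV, hG, hg]; ring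
  have hgsq : ∀ t, |g t ^ 2| ≤ 1 := fun t => by
    rw [abs_pow]; exact pow_le_one₀ (abs_nonneg _) (hg1 t)
  have hint : IntegrableOn (fun t => g t ^ 2) (Ioi 0) := by
    refine integrableOn_Ioi_of_intervalIntegral_norm_bounded Q 0
      (fun b => (intervalIntegrable_of_abs_le (hgm.pow_const 2) hgsq 0 b).1) Filter.tendsto_id ?_
    filter_upwards [Filter.eventually_ge_atTop 0] with T hT
    refine le_trans (le_of_eq ?_) (hQ T hT)
    refine intervalIntegral.integral_congr fun t _ => ?_
    simp only [Real.norm_eq_abs, hg]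
    rw [abs_of_nonneg (sq_nonneg _)]
  have hint' : Integrable fun t => g t ^ 2 := by
    rw [← integrableOn_univ, ← Iic_union_Ioi (a := (0 : ℝ))]
    refine IntegrableOn.union ?_ hint
    refine (integrableOn_zero : IntegrableOn (fun _ : ℝ => (0 : ℝ)) (Iic 0) volume).congr_fun (fun t ht => ?_)
      measurableSet_Iic
    simp [hg0 t ht]
  have hVlim := tendsto_integral_kernelTail_mul hgm hint'
  have hflim : Filter.Tendsto (fun t => f t - L) Filter.atTop (nhds 0) := by
    refine squeeze_zero_norm' ?_ (by
      simpa using Real.tendsto_exp_neg_atTop_nhds_zero.const_mul D')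
    filter_upwards [Filter.eventually_gt_atTop 0] with t ht
    exact hD' t ht
  have hlim : Filter.Tendsto z Filter.atTop (nhds 0) := by
    -- Here z - Y = (f - L) + V, and both summands tend to zero; Y is 1-Lipschitz since |g| ≤ 1 and
    -- 1/π ≤ 1.
    refine tendsto_zero_of_integrable_sq_tanh hβ.1 hzm hint (Y := fun t => L - 1 / Real.pi * G t)
      (fun s t => ?_) ?_
    · rw [show L - 1 / Real.pi * G s - (L - 1 / Real.pi * G t) = -(1 / Real.pi * (G s - G t)) by
        ring, abs_neg, abs_mul, abs_of_nonneg (by positivity : 0 ≤ 1 / Real.pi)]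
      exact (mul_le_of_le_one_left (abs_nonneg _)
        ((div_le_one (by linarith)).mpr (by linarith))).trans (hGlip s t)
    · have := hflim.add hVlim
      rw [add_zero] at this
      refine this.congr fun t => ?_
      simp only [hf, hV]
      ring
  refine hlim.congr' ?_
  filter_upwards [Filter.eventually_gt_atTop 0] with t ht
  exact hzy t ht
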